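/- Let $\mathbb S=\mathbb R/\mathbb Z$ with Lebesgue measure $\mathfrak m$, let $(\Omega,\mathcal F,\eta)$ be a probability space, and for each $\omega\in\Omega$ let $T_\omega:\mathbb S\to\mathbb S$ be a $C^2$ map with $T_\omega'\neq 0$ everywhere, such that $(\omega,x)\mapsto T_\omega x$ is measurable. Put $\lambda_\omega=\inf|T_\omega'|$ and $\Delta_\omega=\|T_\omega''/(T_\omega')^2\|_\infty$, and assume $\int\lambda_\omega^{-2}\,d\eta(\omega)<1$ and $\int\Delta_\omega^2\,d\eta(\omega)<\infty$. Let $\mathcal Qf(x)=\int f(T_\omega x)\,d\eta(\omega)$ for bounded measurable $f$. A probability measure $\mu$ on $\mathbb S$ is called stationary if $\int\mathcal Qf\,d\mu=\int f\,d\mu$ for all bounded measurable $f$; a stationary $\mu$ is called ergodic if every bounded measurable $f$ with $\mathcal Qf=f$ $\mu$-almost everywhere is $\mu$-almost everywhere constant. Then there exists a stationary probability measure that has a density with respect to $\mathfrak m$ which is Lipschitz continuous and bounded away from zero. Moreover, any such measure $\mu$ is the unique absolutely continuous ergodic measure: $\mu$ is absolutely continuous with respect to $\mathfrak m$ and ergodic,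 and every ergodic measure $\nu$ that is absolutely continuous with respect to $\mathfrak m$ equals $\mu$. -/

import Mathlib

open MeasureTheory

noncomputable section

namespace RandomCircle

/-- `F : ℝ → ℝ` is a `C²` lift without critical points of the circle map `T`. A circle map is `C²`
without critical points exactly when it has such a lift; all its lifts differ by integer constants,
so that `T'` and `T''` at the class of `x` are `deriv F x` and `deriv (deriv F) x` for any of
them. -/
structure IsC2Lift (T : UnitAddCircle → UnitAddCircle) (F : ℝ → ℝ) : Prop where
  map_coe : ∀ x : ℝ, T (x : UnitAddCircle) = (F x : UnitAddCircle)
  contDiff : ContDiff ℝ 2 F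
  deriv_ne_zero : ∀ x : ℝ, deriv F x ≠ 0

/-- The dilation `inf |T'|` of a circle map with lift `F`. -/
def dilation (F : ℝ → ℝ) : ℝ := ⨅ x : ℝ, |deriv F x|

/-- The distortion `‖T'' / (T')²‖_∞` of a circle map with lift `F`. -/
def distortion (F : ℝ → ℝ) : ℝ := ⨆ x : ℝ, |deriv (deriv F) x / (deriv F x) ^ 2|

/-- The standing assumptions on a random family `ω ↦ T ω` of circle maps, `ω` being distributed
according to `η`, with lifts `F ω`. -/
structure IsAdmissible {Ω : Type*} [MeasurableSpace Ω] (η : Measure Ω)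
    (T : Ω → UnitAddCircle → UnitAddCircle) (F : Ω → ℝ → ℝ) : Prop where
  isC2Lift : ∀ ω, IsC2Lift (T ω) (F ω)
  measurable : Measurable fun p : Ω × UnitAddCircle => T p.1 p.2
  dilation_moment : ∫⁻ ω, ENNReal.ofReal ((dilation (F ω) ^ 2)⁻¹) ∂η < 1
  distortion_moment : ∫⁻ ω, ENNReal.ofReal (distortion (F ω) ^ 2) ∂η < ⊤

/-- The Markov operator of the chain `X (n + 1) = T ω (X n)` with independent `ω ∼ η`. -/
def markovOp {Ω : Type*} [MeasurableSpace Ω] (η : Measure Ω)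
    (T : Ω → UnitAddCircle → UnitAddCircle) (f : UnitAddCircle → ℝ) (x : UnitAddCircle) : ℝ :=
  ∫ ω, f (T ω x) ∂η

/-- `μ` is a stationary probability distribution of the chain. -/
structure IsStationary {Ω : Type*} [MeasurableSpace Ω] (η : Measure Ω)
    (T : Ω → UnitAddCircle → UnitAddCircle) (μ : Measure UnitAddCircle) : Prop where
  isProbabilityMeasure : IsProbabilityMeasure μ
  integral_markovOp : ∀ f : UnitAddCircle → ℝ, Measurable f → (∃ C : ℝ, ∀ x, |f x| ≤ C) →
    ∫ x, markovOp η T f x ∂μ = ∫ x, f x ∂μ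

/-- A stationary distribution is ergodic if the bounded measurable functions that are invariant
under the Markov operator almost everywhere are constant almost everywhere. -/
structure IsErgodic {Ω : Type*} [MeasurableSpace Ω] (η : Measure Ω)
    (T : Ω → UnitAddCircle → UnitAddCircle) (μ : Measure UnitAddCircle) : Prop where
  isStationary : IsStationary η T μ
  ae_const : ∀ f : UnitAddCircle → ℝ, Measurable f → (∃ C : ℝ, ∀ x, |f x| ≤ C) →
    (∀ᵐ x ∂μ, markovOp η T f x = f x) → ∃ c : ℝ, ∀ᵐ x ∂μ, f x = c

/-- `μ` has a density with respect to Lebesgue measure which is Lipschitz continuous and bounded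
away from zero. -/
def HasLipschitzPositiveDensity (μ : Measure UnitAddCircle) : Prop :=
  ∃ φ : UnitAddCircle → ℝ, (∃ L : NNReal, LipschitzWith L φ) ∧ (∃ c : ℝ, 0 < c ∧ ∀ x, c ≤ φ x) ∧
    μ = (volume : Measure UnitAddCircle).withDensity fun x => ENNReal.ofReal (φ x)

end RandomCircle

end

namespace RandomCircle

open Set Filter Topology Function

universe u

/-! The push-forward of a density `h` under one map is studied through `u t = ∫ φ (F x + t) * h x`
with `φ ≥ 0`. If `|h'| ≤ ρ h`, `1/|F'| ≤ ℓ` and the distortion is at most `a`, integration by parts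
gives `|u'| ≤ σ u` with `σ = ρ ℓ + a`: a map turns the log-Lipschitz constant `ρ` into `ρ ℓ + a`,
and inverse branches never appear. The mean of `u` over a period is `∫ φ * ∫ h`, so Gronwall's
inequality yields a lower bound with factor `exp (-σ)` and a Lipschitz bound quadratic in `σ`. The
quadratic growth is what the second moments pay for.

Composing independent maps multiplies the `ℓ`s and replaces the distortion `a'` of the inner map by
`a + ℓ a'`. As `∫ ℓ² < 1`, the `n`-fold composition has distortion bounded in mean square uniformly
in `n`, while its `ℓ` decays geometrically (`exists_iterate`). Averaging over the noise gives
`exists_uniform_bounds`: from Lebesgue measure the laws are uniformly Lipschitz and bounded below,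
and every positive `C¹` density eventually dominates `c` times its mass, with `c` independent of the
density because the term `ρ ℓ` dies out.

Existence follows by Arzelà–Ascoli for smoothed Cesàro averages. The rest is a Doeblin argument: by
`L¹` approximation the minorization holds for every absolutely continuous law up to an arbitrarily
small mass. Used repeatedly on what remains of `ν` after removing a multiple of `μ`, it forces `ν =
μ`; used on `f - essInf f` for a bounded harmonic `f`, it forces `f` to be constant. -/

/-- A lift of a circle map increases by a fixed integer along each period. -/
lemma IsC2Lift.exists_degree {T : UnitAddCircle → UnitAddCircle} {F : ℝ → ℝ}
    (h : IsC2Lift T F) : ∃ k : ℤ, ∀ x, F (x + 1) = F x + k := by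
  have h1 : ∀ x, ∃ k : ℤ, (k : ℝ) = F (x + 1) - F x := by
    intro x
    have : ((F (x + 1) : ℝ) : UnitAddCircle) = (F x : ℝ) := by
      rw [← h.map_coe, ← h.map_coe]
      congr 1
      exact AddCircle.coe_add_period 1 x
    rw [← sub_eq_zero, ← AddCircle.coe_sub, AddCircle.coe_eq_zero_iff] at this
    simpa using this
  choose k hk using h1
  have hc : Continuous k := by
    rw [Int.isClosedEmbedding_coe_real.isInducing.continuous_iff]
    have : (fun x : ℝ => (k x : ℝ)) = fun x => F (x + 1) - F x := funext hk
    show Continuous (fun x : ℝ => (k x : ℝ))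
    rw [this]
    have := h.contDiff.continuous
    fun_prop
  refine ⟨k 0, fun x => ?_⟩
  have := PreconnectedSpace.constant inferInstance hc (x := x) (y := 0)
  rw [← this, hk]
  ring

lemma periodic_deriv_of_add_one {F : ℝ → ℝ} {k : ℝ} (hk : ∀ x, F (x + 1) = F x + k) :
    Periodic (deriv F) 1 := by
  intro x
  rw [← deriv_comp_add_const]
  simp [hk]

lemma periodic_deriv {f : ℝ → ℝ} (hf : Periodic f 1) : Periodic (deriv f) 1 :=
  periodic_deriv_of_add_one (k := 0) (by simpa using hf)

/-! ### Push-forward of a density by a single map -/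

section Deterministic

variable {F φ h : ℝ → ℝ} {k : ℤ} {ℓ a ρ : ℝ}

lemma periodic_comp_lift (hk : ∀ x, F (x + 1) = F x + k) (hφ : Periodic φ 1) (t : ℝ) :
    Periodic (fun x => φ (F x + t)) 1 := by
  intro x
  have := hφ.int_mul k (F x + t)
  simp only [hk]
  rw [← this]
  congr 1
  ring

lemma hasDerivAt_integral_comp_add (hF : Continuous F) (hh : Continuous h)
    (hφ : ContDiff ℝ 1 φ) (hφ1 : Periodic φ 1) (t : ℝ) :
    HasDerivAt (fun t => ∫ x in (0 : ℝ)..1, φ (F x + t) * h x)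
      (∫ x in (0 : ℝ)..1, deriv φ (F x + t) * h x) t := by
  have hd : Continuous (deriv φ) := hφ.continuous_deriv le_rfl
  have hφc := hφ.continuous
  obtain ⟨C, hC⟩ := ((periodic_deriv hφ1).isBounded_of_continuous one_ne_zero hd).exists_norm_le
  refine (intervalIntegral.hasDerivAt_integral_of_dominated_loc_of_deriv_le
    (F := fun t x => φ (F x + t) * h x) (F' := fun t x => deriv φ (F x + t) * h x)
    (bound := fun x => C * ‖h x‖) univ_mem ?_ ?_ ?_ ?_ ?_ ?_).2
  · exact .of_forall fun s => (by fun_prop : Continuous _).aestronglyMeasurable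
  · exact (by fun_prop : Continuous _).intervalIntegrable _ _
  · exact (by fun_prop : Continuous _).aestronglyMeasurable
  · refine .of_forall fun x _ s _ => ?_
    rw [norm_mul]
    exact mul_le_mul_of_nonneg_right (hC _ (mem_range_self _)) (norm_nonneg _)
  · exact (by fun_prop : Continuous _).intervalIntegrable _ _
  · refine .of_forall fun x _ s _ => HasDerivAt.mul_const ?_ _
    have := (hφ.differentiable one_ne_zero (F x + s)).hasDerivAt.comp_const_add (F x) s
    exact this

/-- Integration by parts: the derivative moves from the test function to the density, at the price
of the distortion and of `h' / F'`. -/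
lemma integral_deriv_comp_mul (hF : ContDiff ℝ 2 F) (hk : ∀ x, F (x + 1) = F x + k)
    (hF0 : ∀ x, deriv F x ≠ 0) (hφ : ContDiff ℝ 1 φ) (hφ1 : Periodic φ 1)
    (hh : ContDiff ℝ 1 h) (hh1 : Periodic h 1) (t : ℝ) :
    ∫ x in (0 : ℝ)..1, deriv φ (F x + t) * h x =
      ∫ x in (0 : ℝ)..1, φ (F x + t) *
        (deriv (deriv F) x / deriv F x ^ 2 * h x - deriv h x * (deriv F x)⁻¹) := by
  have hF1 : ContDiff ℝ 1 (deriv F) := (contDiff_succ_iff_deriv (n := 1).1 hF).2.2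
  have hF1c := hF1.continuous
  have hF2c : Continuous (deriv (deriv F)) := hF1.continuous_deriv le_rfl
  have hd : Continuous (deriv φ) := hφ.continuous_deriv le_rfl
  have hhd : Continuous (deriv h) := hh.continuous_deriv le_rfl
  have hφc := hφ.continuous
  have hFc := hF.continuous
  have hhc := hh.continuous
  have hinv : Continuous fun x => (deriv F x)⁻¹ := hF1c.inv₀ hF0
  -- Writing `φ' ∘ F = (φ ∘ F)' / F'` makes this the primitive to use. It is 1-periodic, since `F`
  -- gains an integer over a period, so there is no boundary term.
  have key : ∀ x, HasDerivAt (fun x => φ (F x + t) * (h x * (deriv F x)⁻¹))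
      (deriv φ (F x + t) * h x - φ (F x + t) *
        (deriv (deriv F) x / deriv F x ^ 2 * h x - deriv h x * (deriv F x)⁻¹)) x := by
    intro x
    have e1 : HasDerivAt F (deriv F x) x := (hF.differentiable two_ne_zero x).hasDerivAt
    have e2 := (hF1.differentiable one_ne_zero x).hasDerivAt
    have e3 := (hh.differentiable one_ne_zero x).hasDerivAt
    have e4 : HasDerivAt (fun x => φ (F x + t)) (deriv φ (F x + t) * deriv F x) x :=
      (hφ.differentiable one_ne_zero (F x + t)).hasDerivAt.comp x (e1.add_const t)
    refine (e4.mul (e3.mul (e2.inv (hF0 x)))).congr_deriv ?_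
    have := hF0 x
    simp only [Pi.inv_apply, Pi.mul_apply]
    field_simp
    ring
  have c1 : Continuous fun x => deriv φ (F x + t) * h x := by fun_prop
  have c2 : Continuous fun x => φ (F x + t) *
        (deriv (deriv F) x / deriv F x ^ 2 * h x - deriv h x * (deriv F x)⁻¹) := by
    simp only [div_eq_mul_inv, ← inv_pow]
    fun_prop
  have := intervalIntegral.integral_eq_sub_of_hasDerivAt (a := 0) (b := 1) (fun x _ => key x)
    ((c1.sub c2).intervalIntegrable _ _)
  rw [intervalIntegral.integral_sub (c1.intervalIntegrable _ _) (c2.intervalIntegrable _ _)] at this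
  have p1 := periodic_comp_lift hk hφ1 t 0
  have p2 := hh1 0
  have p3 := periodic_deriv_of_add_one hk 0
  rw [zero_add] at p1 p2 p3
  simp only at p1
  rw [p1, p2, p3, sub_self, sub_eq_zero] at this
  exact this

/-- The standing regularity of a lift `F`, a test function `φ` and a density `h`. -/
structure TransferData (F φ h : ℝ → ℝ) (k : ℤ) (ℓ a ρ : ℝ) : Prop where
  hF : ContDiff ℝ 2 F
  hk : ∀ x, F (x + 1) = F x + k
  hF0 : ∀ x, deriv F x ≠ 0
  hℓ : ∀ x, |(deriv F x)⁻¹| ≤ ℓ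
  ha : ∀ x, |deriv (deriv F) x / deriv F x ^ 2| ≤ a
  hφ : ContDiff ℝ 1 φ
  hφ1 : Periodic φ 1
  hφ0 : ∀ x, 0 ≤ φ x
  hh : ContDiff ℝ 1 h
  hh1 : Periodic h 1
  hh0 : ∀ x, 0 ≤ h x
  hρ : ∀ x, |deriv h x| ≤ ρ * h x
  hρ0 : 0 ≤ ρ

/-- Weak form of the statement that the push-forward density has logarithmic derivative at most `ρ ℓ
+ a`. -/
lemma TransferData.abs_integral_deriv_le (S : TransferData F φ h k ℓ a ρ) (t : ℝ) :
    |∫ x in (0 : ℝ)..1, deriv φ (F x + t) * h x| ≤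
      (ρ * ℓ + a) * ∫ x in (0 : ℝ)..1, φ (F x + t) * h x := by
  rw [integral_deriv_comp_mul S.hF S.hk S.hF0 S.hφ S.hφ1 S.hh S.hh1,
    ← intervalIntegral.integral_const_mul, ← Real.norm_eq_abs]
  have hφc := S.hφ.continuous
  have hFc := S.hF.continuous
  have hhc := S.hh.continuous
  refine intervalIntegral.norm_integral_le_of_norm_le zero_le_one ?_
    ((by fun_prop : Continuous _).intervalIntegrable _ _)
  refine .of_forall fun x _ => ?_
  rw [norm_mul, Real.norm_of_nonneg (S.hφ0 _)]
  have : ‖deriv (deriv F) x / deriv F x ^ 2 * h x - deriv h x * (deriv F x)⁻¹‖ ≤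
      (ρ * ℓ + a) * h x := by
    refine (norm_sub_le _ _).trans ?_
    rw [norm_mul, norm_mul, Real.norm_of_nonneg (S.hh0 x)]
    have h1 := mul_le_mul_of_nonneg_right (S.ha x) (S.hh0 x)
    have h2 := mul_le_mul (S.hρ x) (S.hℓ x) (abs_nonneg _) (mul_nonneg S.hρ0 (S.hh0 x))
    simp only [Real.norm_eq_abs]
    linarith
  calc _ ≤ φ (F x + t) * ((ρ * ℓ + a) * h x) := mul_le_mul_of_nonneg_left this (S.hφ0 _)
    _ = _ := by ring

/-- Gronwall's inequality for `|u'| ≤ σ u`: `u t * exp (σ t)` increases and `u t * exp (-σ t)`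
decreases. -/
lemma TransferData.exp_mul_le (S : TransferData F φ h k ℓ a ρ) (s t : ℝ) :
    Real.exp (-((ρ * ℓ + a) * |t - s|)) * (∫ x in (0 : ℝ)..1, φ (F x + s) * h x) ≤
      ∫ x in (0 : ℝ)..1, φ (F x + t) * h x := by
  set σ := ρ * ℓ + a
  set u : ℝ → ℝ := fun t => ∫ x in (0 : ℝ)..1, φ (F x + t) * h x
  have hu : ∀ t, HasDerivAt u (∫ x in (0 : ℝ)..1, deriv φ (F x + t) * h x) t :=
    hasDerivAt_integral_comp_add S.hF.continuous S.hh.continuous S.hφ S.hφ1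
  have hb : ∀ t, |∫ x in (0 : ℝ)..1, deriv φ (F x + t) * h x| ≤ σ * u t :=
    S.abs_integral_deriv_le
  have he : ∀ (σ t : ℝ), HasDerivAt (fun t => Real.exp (σ * t)) (Real.exp (σ * t) * σ) t := by
    intro σ t
    simpa using ((hasDerivAt_id t).const_mul σ).exp
  have hv : ∀ (σ t : ℝ), HasDerivAt (fun t => u t * Real.exp (σ * t))
      (((∫ x in (0 : ℝ)..1, deriv φ (F x + t) * h x) + σ * u t) * Real.exp (σ * t)) t := by
    intro σ t
    refine ((hu t).mul (he σ t)).congr_deriv ?_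
    ring
  have hmono : Monotone fun t => u t * Real.exp (σ * t) := by
    refine monotone_of_deriv_nonneg (fun t => (hv σ t).differentiableAt) fun t => ?_
    rw [(hv σ t).deriv]
    have := neg_le_of_abs_le (hb t)
    exact mul_nonneg (by linarith) (Real.exp_pos _).le
  have hanti : Antitone fun t => u t * Real.exp (-σ * t) := by
    refine antitone_of_deriv_nonpos (fun t => (hv (-σ) t).differentiableAt) fun t => ?_
    rw [(hv (-σ) t).deriv]
    have := le_of_abs_le (hb t)
    exact mul_nonpos_of_nonpos_of_nonneg (by linarith) (Real.exp_pos _).le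
  change Real.exp (-(σ * |t - s|)) * u s ≤ u t
  rcases le_total s t with hst | hst
  · have h1 := hmono hst
    simp only at h1
    rw [abs_of_nonneg (by linarith), show -(σ * (t - s)) = σ * s + -(σ * t) by ring, Real.exp_add,
      Real.exp_neg]
    have := Real.exp_pos (σ * t)
    rw [mul_comm, ← mul_assoc, mul_inv_le_iff₀ this]
    exact h1
  · have h1 := hanti hst
    simp only at h1
    rw [abs_of_nonpos (by linarith), show -(σ * (-(t - s))) = -σ * s + -(-σ * t) by ring,
      Real.exp_add, Real.exp_neg]
    have := Real.exp_pos (-σ * t)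
    rw [mul_comm, ← mul_assoc, mul_inv_le_iff₀ this]
    exact h1

lemma TransferData.continuous_integral (S : TransferData F φ h k ℓ a ρ) :
    Continuous fun t => ∫ x in (0 : ℝ)..1, φ (F x + t) * h x :=
  continuous_iff_continuousAt.2 fun t => (hasDerivAt_integral_comp_add S.hF.continuous
    S.hh.continuous S.hφ S.hφ1 t).continuousAt

/-- By Fubini, averaging over all translations erases the map: a periodic `φ` has the same integral
over every period. -/
lemma TransferData.integral_integral (S : TransferData F φ h k ℓ a ρ) :
    ∫ t in (0 : ℝ)..1, ∫ x in (0 : ℝ)..1, φ (F x + t) * h x =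
      (∫ x in (0 : ℝ)..1, φ x) * ∫ x in (0 : ℝ)..1, h x := by
  have hφc := S.hφ.continuous
  have hFc := S.hF.continuous
  have hhc := S.hh.continuous
  rw [intervalIntegral_intervalIntegral_swap]
  · have : ∀ x, ∫ t in (0 : ℝ)..1, φ (F x + t) * h x = (∫ x in (0 : ℝ)..1, φ x) * h x := by
      intro x
      rw [intervalIntegral.integral_mul_const, intervalIntegral.integral_comp_add_left]
      have := S.hφ1.intervalIntegral_add_eq (F x) 0
      rw [add_zero, this, zero_add]
    simp_rw [this]
    rw [intervalIntegral.integral_const_mul]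
  · have hc : Continuous (Function.uncurry fun t x => φ (F x + t) * h x) := by
      simp only [Function.uncurry_def]
      fun_prop
    refine (hc.continuousOn.integrableOn_compact
      (isCompact_Icc (a := ((0 : ℝ), (0 : ℝ))) (b := (1, 1)))).mono_set ?_
    rw [uIoc_of_le zero_le_one, ← Icc_prod_Icc]
    exact prod_mono Ioc_subset_Icc_self Ioc_subset_Icc_self

lemma TransferData.nonneg (S : TransferData F φ h k ℓ a ρ) : 0 ≤ ρ * ℓ + a :=
  add_nonneg (mul_nonneg S.hρ0 ((abs_nonneg _).trans (S.hℓ 0))) ((abs_nonneg _).trans (S.ha 0))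

lemma TransferData.integral_nonneg (S : TransferData F φ h k ℓ a ρ) (t : ℝ) :
    0 ≤ ∫ x in (0 : ℝ)..1, φ (F x + t) * h x :=
  intervalIntegral.integral_nonneg zero_le_one fun _ _ => mul_nonneg (S.hφ0 _) (S.hh0 _)

/-- Every translate by `t ∈ [0, 1]` is comparable to the untranslated integral, hence so is their
average `∫ φ * ∫ h`. -/
lemma TransferData.exp_mul_integral_le (S : TransferData F φ h k ℓ a ρ) :
    Real.exp (-(ρ * ℓ + a)) * ((∫ x in (0 : ℝ)..1, φ x) * ∫ x in (0 : ℝ)..1, h x) ≤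
      ∫ x in (0 : ℝ)..1, φ (F x) * h x := by
  rw [← S.integral_integral, ← intervalIntegral.integral_const_mul]
  have hc := S.continuous_integral
  calc _ ≤ ∫ t in (0 : ℝ)..1, ∫ x in (0 : ℝ)..1, φ (F x + 0) * h x := by
        refine intervalIntegral.integral_mono_on zero_le_one
          ((by fun_prop : Continuous _).intervalIntegrable _ _) (by simp) fun t ht => ?_
        refine le_trans ?_ (S.exp_mul_le t 0)
        refine mul_le_mul_of_nonneg_right (Real.exp_le_exp.2 (neg_le_neg ?_)) (S.integral_nonneg t)
        refine mul_le_of_le_one_right S.nonneg ?_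
        rw [zero_sub, abs_neg, abs_of_nonneg ht.1]
        exact ht.2
    _ = _ := by simp

/-- Averaging only over a window of length `1 / (1 + σ)`, on which the exponential loses at most a
factor `e`, makes the bound linear in `σ`. A bound exponential in `σ` would not be controlled by
second moments. -/
lemma TransferData.integral_le (S : TransferData F φ h k ℓ a ρ) :
    ∫ x in (0 : ℝ)..1, φ (F x) * h x ≤ Real.exp 1 * (1 + (ρ * ℓ + a)) *
      ((∫ x in (0 : ℝ)..1, φ x) * ∫ x in (0 : ℝ)..1, h x) := by
  have hc := S.continuous_integral
  set σ := ρ * ℓ + a with hσ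
  have hσ0 : 0 ≤ σ := S.nonneg
  set τ := (1 + σ)⁻¹
  have hτ0 : 0 < τ := by positivity
  have hτ1 : τ ≤ 1 := inv_le_one_of_one_le₀ (by linarith)
  have hστ : σ * τ ≤ 1 := by
    rw [← div_eq_mul_inv, div_le_one (by linarith)]; linarith
  set A := ∫ x in (0 : ℝ)..1, φ (F x) * h x
  have hA : 0 ≤ A := by simpa using S.integral_nonneg 0
  have h1 : τ * (Real.exp (-1) * A) ≤ ∫ t in (0 : ℝ)..1, ∫ x in (0 : ℝ)..1, φ (F x + t) * h x := by
    calc τ * (Real.exp (-1) * A) = ∫ t in (0 : ℝ)..τ, Real.exp (-1) * A := by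
          simp [mul_left_comm]
      _ ≤ ∫ t in (0 : ℝ)..τ, ∫ x in (0 : ℝ)..1, φ (F x + t) * h x := by
        refine intervalIntegral.integral_mono_on hτ0.le (by simp) (hc.intervalIntegrable _ _)
          fun t ht => ?_
        have := S.exp_mul_le 0 t
        simp only [add_zero, sub_zero] at this
        refine le_trans (mul_le_mul_of_nonneg_right (Real.exp_le_exp.2 (neg_le_neg ?_)) hA) this
        rw [abs_of_nonneg ht.1]
        exact (mul_le_mul_of_nonneg_left ht.2 hσ0).trans hστ
      _ ≤ _ := by
        refine intervalIntegral.integral_mono_interval le_rfl hτ0.le hτ1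
          (.of_forall fun t => S.integral_nonneg t) (hc.intervalIntegrable _ _)
  rw [S.integral_integral] at h1
  calc A = (Real.exp 1 * (1 + σ)) * (τ * (Real.exp (-1) * A)) := by
        rw [Real.exp_neg]
        have := Real.exp_pos 1
        simp only [τ]
        field_simp
    _ ≤ _ := mul_le_mul_of_nonneg_left h1 (by positivity)

/-- From `1 - exp (-σ|t|) ≤ σ|t|` and the linear upper bound; the product is quadratic in `σ`. -/
lemma TransferData.sub_le (S : TransferData F φ h k ℓ a ρ) (t : ℝ) :
    (∫ x in (0 : ℝ)..1, φ (F x) * h x) - (∫ x in (0 : ℝ)..1, φ (F x + t) * h x) ≤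
      Real.exp 1 * ((ρ * ℓ + a) * (1 + (ρ * ℓ + a))) * |t| *
      ((∫ x in (0 : ℝ)..1, φ x) * ∫ x in (0 : ℝ)..1, h x) := by
  have h1 := S.exp_mul_le 0 t
  simp only [add_zero, sub_zero] at h1
  have h2 := S.integral_le
  have h3 : 0 ≤ ∫ x in (0 : ℝ)..1, φ (F x) * h x := by simpa using S.integral_nonneg 0
  have h4 := Real.add_one_le_exp (-((ρ * ℓ + a) * |t|))
  have h5 := mul_le_mul_of_nonneg_right h4 h3
  have h6 : 0 ≤ (ρ * ℓ + a) * |t| := mul_nonneg S.nonneg (abs_nonneg _)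
  have h7 := mul_le_mul_of_nonneg_left h2 h6
  linarith

end Deterministic

/-! ### From the line to the circle, and from `C¹` to continuous test functions -/

lemma IsC2Lift.continuous {T : UnitAddCircle → UnitAddCircle} {F : ℝ → ℝ}
    (h : IsC2Lift T F) : Continuous T := by
  have hq : IsQuotientMap ((↑) : ℝ → UnitAddCircle) := QuotientAddGroup.isQuotientMap_mk _
  rw [hq.continuous_iff]
  have : T ∘ ((↑) : ℝ → UnitAddCircle) = fun x => ((F x : ℝ) : UnitAddCircle) := funext h.map_coe
  rw [this]
  exact (AddCircle.continuous_mk' 1).comp h.contDiff.continuous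

lemma norm_coe_le_abs (s : ℝ) : ‖(s : UnitAddCircle)‖ ≤ |s| := by
  rw [UnitAddCircle.norm_eq]
  simpa using round_le s 0

lemma exists_coe_eq_abs_eq_norm (t : UnitAddCircle) :
    ∃ s : ℝ, (s : UnitAddCircle) = t ∧ |s| = ‖t‖ := by
  induction t using QuotientAddGroup.induction_on with
  | H x =>
    refine ⟨x - round x, ?_, (UnitAddCircle.norm_eq).symm⟩
    have : ((round x : ℝ) : UnitAddCircle) = 0 := AddCircle.coe_eq_zero_iff 1 |>.2 ⟨round x, by simp⟩
    rw [AddCircle.coe_sub, this, sub_zero]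

lemma periodic_comp_coe (f : UnitAddCircle → ℝ) : Periodic (fun x : ℝ => f x) 1 := by
  intro x
  simp only [AddCircle.coe_add_period]

lemma continuous_coe : Continuous ((↑) : ℝ → UnitAddCircle) := AddCircle.continuous_mk' 1

lemma continuous_of_contDiff_comp_coe {f : UnitAddCircle → ℝ}
    (hf : ContDiff ℝ 1 fun x : ℝ => f x) : Continuous f := by
  have hq : IsQuotientMap ((↑) : ℝ → UnitAddCircle) := QuotientAddGroup.isQuotientMap_mk _
  exact hq.continuous_iff.2 hf.continuous

/-- Continuous functions on the circle are uniform limits of `C¹` functions. -/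
lemma exists_contDiff_approx {f : UnitAddCircle → ℝ} (hf : Continuous f) {ε : ℝ} (hε : 0 < ε) :
    ∃ g : UnitAddCircle → ℝ, ContDiff ℝ 1 (fun x : ℝ => g x) ∧ (∀ x, |g x - f x| ≤ ε) ∧
      ((∀ x, 0 ≤ f x) → ∀ x, 0 ≤ g x) := by
  obtain ⟨δ, hδ, H⟩ := Metric.uniformContinuous_iff.1
    (CompactSpace.uniformContinuous_of_continuous hf) ε hε
  have hδ' : 0 < δ / 2 := by linarith
  have hcs := continuous_coe
  have hfc : Continuous fun x : ℝ => f x := hf.comp continuous_coe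
  -- The approximant is the average of `f` over an arc of length `δ / 2` starting at `x`; it is `C¹`
  -- by the fundamental theorem of calculus.
  refine ⟨fun x => (δ / 2)⁻¹ * ∫ s in (0 : ℝ)..(δ / 2), f (x + s), ?_, fun x => ?_, fun h0 x => ?_⟩
  · have h1 : (fun x : ℝ => (δ / 2)⁻¹ * ∫ s in (0 : ℝ)..(δ / 2), f ((x : UnitAddCircle) + s)) =
        fun x => (δ / 2)⁻¹ * ((∫ s in (0 : ℝ)..(x + δ / 2), f s) - ∫ s in (0 : ℝ)..x, f s) := by
      ext x
      rw [intervalIntegral.integral_interval_sub_left (hfc.intervalIntegrable _ _)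
        (hfc.intervalIntegrable _ _)]
      have := intervalIntegral.integral_comp_add_left (a := 0) (b := δ / 2) (fun s : ℝ => f s) x
      simp only [AddCircle.coe_add, add_zero] at this
      rw [this]
    rw [h1]
    have h2 : ContDiff ℝ 1 fun x : ℝ => ∫ s in (0 : ℝ)..x, f s := by
      rw [contDiff_one_iff_deriv]
      refine ⟨fun x => (hfc.integral_hasStrictDerivAt 0 x).hasDerivAt.differentiableAt, ?_⟩
      rw [show deriv (fun x : ℝ => ∫ s in (0 : ℝ)..x, f s) = fun x : ℝ => f x from
        funext fun x => hfc.deriv_integral _ _ _]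
      exact hfc
    have h3 : ContDiff ℝ 1 fun x : ℝ => ∫ s in (0 : ℝ)..(x + δ / 2), f s :=
      h2.comp (contDiff_id.add contDiff_const)
    exact contDiff_const.mul (h3.sub h2)
  · have hc : Continuous fun s : ℝ => f (x + s) := by fun_prop
    have h1 : (δ / 2)⁻¹ * (∫ s in (0 : ℝ)..(δ / 2), f (x + s)) - f x =
        (δ / 2)⁻¹ * ∫ s in (0 : ℝ)..(δ / 2), (f (x + s) - f x) := by
      rw [intervalIntegral.integral_sub (hc.intervalIntegrable _ _) (by simp)]
      simp only [intervalIntegral.integral_const, sub_zero, smul_eq_mul]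
      field_simp
    rw [h1, abs_mul, abs_of_pos (by positivity)]
    have h2 : ‖∫ s in (0 : ℝ)..(δ / 2), (f (x + s) - f x)‖ ≤ ε * |δ / 2 - 0| := by
      refine intervalIntegral.norm_integral_le_of_norm_le_const fun s hs => ?_
      rw [uIoc_of_le hδ'.le] at hs
      rw [Real.norm_eq_abs, ← Real.dist_eq]
      refine (H ?_).le
      rw [dist_eq_norm, add_sub_cancel_left]
      refine (norm_coe_le_abs s).trans_lt ?_
      rw [abs_of_pos hs.1]
      linarith [hs.2]
    rw [sub_zero, abs_of_pos hδ'] at h2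
    rw [inv_mul_le_iff₀ hδ', mul_comm]
    exact h2
  · exact mul_nonneg (by positivity) (intervalIntegral.integral_nonneg hδ'.le fun s _ => h0 _)

lemma exists_contDiff_seq {f : UnitAddCircle → ℝ} (hf : Continuous f) (h0 : ∀ x, 0 ≤ f x) :
    ∃ g : ℕ → UnitAddCircle → ℝ, (∀ n, ContDiff ℝ 1 (fun x : ℝ => g n x)) ∧
      (∀ n x, |g n x - f x| ≤ 1 / ((n : ℝ) + 1)) ∧ ∀ n x, 0 ≤ g n x := by
  choose g h1 h2 h3 using fun n : ℕ => exists_contDiff_approx hf (Nat.one_div_pos_of_nat (n := n))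
  exact ⟨g, h1, h2, fun n => h3 n h0⟩

lemma tendsto_integral_of_uniform {g : ℕ → UnitAddCircle → ℝ} {f h : UnitAddCircle → ℝ}
    (hf : Continuous f) (hg : ∀ n, Continuous (g n)) (hh : Continuous h)
    (hgf : ∀ n x, |g n x - f x| ≤ 1 / ((n : ℝ) + 1)) {S : UnitAddCircle → UnitAddCircle}
    (hS : Continuous S) :
    Tendsto (fun n => ∫ x, g n (S x) * h x) atTop (𝓝 (∫ x, f (S x) * h x)) := by
  obtain ⟨C, hC⟩ := (isCompact_range hf).isBounded.exists_norm_le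
  refine tendsto_integral_of_dominated_convergence (fun x => (C + 1) * ‖h x‖) ?_ ?_ ?_ ?_
  · exact fun n => (((hg n).comp hS).mul hh).aestronglyMeasurable
  · exact (by fun_prop : Continuous _).integrable_of_hasCompactSupport
      (HasCompactSupport.of_compactSpace _)
  · refine fun n => .of_forall fun x => ?_
    rw [norm_mul]
    refine mul_le_mul_of_nonneg_right ?_ (norm_nonneg _)
    have h1 := hC _ (mem_range_self (S x))
    have h2 := hgf n (S x)
    have h3 : 1 / ((n : ℝ) + 1) ≤ 1 := by
      rw [div_le_one (by positivity)]
      linarith [(Nat.cast_nonneg n : (0 : ℝ) ≤ n)]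
    have h4 : ‖g n (S x)‖ ≤ ‖g n (S x) - f (S x)‖ + ‖f (S x)‖ := by
      simpa using norm_add_le (g n (S x) - f (S x)) (f (S x))
    rw [Real.norm_eq_abs (_ - _)] at h4
    linarith
  · refine .of_forall fun x => Tendsto.mul_const _ ?_
    rw [tendsto_iff_norm_sub_tendsto_zero]
    exact squeeze_zero (fun n => norm_nonneg _) (fun n => hgf n (S x))
      tendsto_one_div_add_atTop_nhds_zero_nat

section

variable {S : UnitAddCircle → UnitAddCircle} {F : ℝ → ℝ} {φ h : UnitAddCircle → ℝ} {ℓ a ρ : ℝ}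

lemma intervalIntegral_comp_coe (f : UnitAddCircle → ℝ) :
    ∫ x in (0 : ℝ)..1, f x = ∫ x, f x := by
  simpa using UnitAddCircle.intervalIntegral_preimage 0 f

lemma exists_transferData (hS : IsC2Lift S F) (hℓ : ∀ x, |(deriv F x)⁻¹| ≤ ℓ)
    (ha : ∀ x, |deriv (deriv F) x / deriv F x ^ 2| ≤ a)
    (hφ : ContDiff ℝ 1 fun x : ℝ => φ x) (hφ0 : ∀ x, 0 ≤ φ x)
    (hh : ContDiff ℝ 1 fun x : ℝ => h x) (hh0 : ∀ x, 0 ≤ h x) (hρ0 : 0 ≤ ρ)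
    (hρ : ∀ x : ℝ, |deriv (fun y : ℝ => h y) x| ≤ ρ * h x) :
    ∃ k, TransferData F (fun x => φ x) (fun x => h x) k ℓ a ρ := by
  obtain ⟨k, hk⟩ := hS.exists_degree
  exact ⟨k, hS.contDiff, hk, hS.deriv_ne_zero, hℓ, ha, hφ, periodic_comp_coe φ, fun x => hφ0 x,
    hh, periodic_comp_coe h, fun x => hh0 x, hρ, hρ0⟩

lemma exp_mul_integral_le (hS : IsC2Lift S F) (hℓ : ∀ x, |(deriv F x)⁻¹| ≤ ℓ)
    (ha : ∀ x, |deriv (deriv F) x / deriv F x ^ 2| ≤ a)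
    (hφ : Continuous φ) (hφ0 : ∀ x, 0 ≤ φ x)
    (hh : ContDiff ℝ 1 fun x : ℝ => h x) (hh0 : ∀ x, 0 ≤ h x) (hρ0 : 0 ≤ ρ)
    (hρ : ∀ x : ℝ, |deriv (fun y : ℝ => h y) x| ≤ ρ * h x) :
    Real.exp (-(ρ * ℓ + a)) * ((∫ x, φ x) * ∫ x, h x) ≤ ∫ x, φ (S x) * h x := by
  have hhc := continuous_of_contDiff_comp_coe hh
  obtain ⟨g, g1, g2, g3⟩ := exists_contDiff_seq hφ hφ0
  have gc := fun n => continuous_of_contDiff_comp_coe (g1 n)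
  have t1 := tendsto_integral_of_uniform hφ gc hhc g2 hS.continuous
  have t2 := tendsto_integral_of_uniform hφ gc (continuous_const (y := (1 : ℝ))) g2 continuous_id
  simp only [id, mul_one] at t2
  refine le_of_tendsto_of_tendsto' ((t2.mul_const _).const_mul _) t1 fun n => ?_
  obtain ⟨k, D⟩ := exists_transferData hS hℓ ha (g1 n) (g3 n) hh hh0 hρ0 hρ
  have := D.exp_mul_integral_le
  simp_rw [← hS.map_coe] at this
  rwa [intervalIntegral_comp_coe, intervalIntegral_comp_coe,
    intervalIntegral_comp_coe (fun x => g n (S x) * h x)] at this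

/-- The density is constant here, so `ρ = 0` and `σ` is just the distortion bound `a`. -/
lemma integral_sub_le (hS : IsC2Lift S F) (hℓ : ∀ x, |(deriv F x)⁻¹| ≤ ℓ)
    (ha : ∀ x, |deriv (deriv F) x / deriv F x ^ 2| ≤ a)
    (hφ : Continuous φ) (hφ0 : ∀ x, 0 ≤ φ x)
    (t : UnitAddCircle) :
    (∫ x, φ (S x)) - ∫ x, φ (S x + t) ≤ Real.exp 1 * (a * (1 + a)) * ‖t‖ * ∫ x, φ x := by
  obtain ⟨s, rfl, hs⟩ := exists_coe_eq_abs_eq_norm t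
  rw [← hs]
  obtain ⟨g, g1, g2, g3⟩ := exists_contDiff_seq hφ hφ0
  have gc := fun n => continuous_of_contDiff_comp_coe (g1 n)
  have t0 := tendsto_integral_of_uniform hφ gc (continuous_const (y := (1 : ℝ))) g2 hS.continuous
  have t1 := tendsto_integral_of_uniform hφ gc (continuous_const (y := (1 : ℝ))) g2
    (hS.continuous.add (continuous_const (y := (s : UnitAddCircle))))
  have t2 := tendsto_integral_of_uniform hφ gc (continuous_const (y := (1 : ℝ))) g2 continuous_id
  simp only [id, mul_one] at t0 t1 t2
  refine le_of_tendsto_of_tendsto' (t0.sub t1) (t2.const_mul _) fun n => ?_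
  obtain ⟨k, D⟩ := exists_transferData hS hℓ ha (g1 n) (g3 n) (h := fun _ => 1) contDiff_const
    (by simp) le_rfl (by simp)
  have := D.sub_le s
  simp_rw [AddCircle.coe_add, ← hS.map_coe] at this
  simp only [mul_one, zero_mul, zero_add, intervalIntegral.integral_const, sub_zero, smul_eq_mul]
    at this
  rwa [intervalIntegral_comp_coe, intervalIntegral_comp_coe (fun x => g n (S x)),
    intervalIntegral_comp_coe (fun x => g n (S x + s))] at this
end

/-! ### Measurability of dilation and distortion -/

lemma tendsto_mul_abs_sub_of_hasDerivAt {f : ℝ → ℝ} {f' x : ℝ} (hf : HasDerivAt f f' x) :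
    Tendsto (fun n : ℕ => ((n : ℝ) + 1) * |f (x + 1 / ((n : ℝ) + 1)) - f x|) atTop (𝓝 |f'|) := by
  have h1 : Tendsto (fun n : ℕ => 1 / ((n : ℝ) + 1)) atTop (𝓝[≠] 0) :=
    tendsto_nhdsWithin_iff.2 ⟨tendsto_one_div_add_atTop_nhds_zero_nat,
      .of_forall fun n => Nat.one_div_pos_of_nat.ne'⟩
  refine (hf.tendsto_slope_zero.comp h1).abs.congr fun n => ?_
  have : (0 : ℝ) < (n : ℝ) + 1 := by positivity
  simp [abs_mul, abs_of_pos this]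

section

variable {T : UnitAddCircle → UnitAddCircle} {F : ℝ → ℝ}

lemma IsC2Lift.contDiff_deriv (h : IsC2Lift T F) : ContDiff ℝ 1 (deriv F) :=
  (contDiff_succ_iff_deriv (n := 1).1 h.contDiff).2.2

lemma IsC2Lift.hasDerivAt (h : IsC2Lift T F) (x : ℝ) : HasDerivAt F (deriv F x) x :=
  (h.contDiff.differentiable two_ne_zero x).hasDerivAt

lemma IsC2Lift.hasDerivAt_deriv (h : IsC2Lift T F) (x : ℝ) :
    HasDerivAt (deriv F) (deriv (deriv F) x) x :=
  (h.contDiff_deriv.differentiable one_ne_zero x).hasDerivAt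

lemma IsC2Lift.continuous_distortion (h : IsC2Lift T F) :
    Continuous fun x => |deriv (deriv F) x / deriv F x ^ 2| :=
  ((h.contDiff_deriv.continuous_deriv le_rfl).div (h.contDiff_deriv.continuous.pow 2)
    fun x => pow_ne_zero _ (h.deriv_ne_zero x)).abs

/-- Expresses `|F'|` through `T` alone. The lifts are not assumed measurable in `ω`, so
measurability must come from `T`. -/
lemma IsC2Lift.tendsto_mul_norm_sub (h : IsC2Lift T F) (x : ℝ) :
    Tendsto (fun n : ℕ => ((n : ℝ) + 1) *
      ‖T ((x + 1 / ((n : ℝ) + 1) : ℝ) : UnitAddCircle) - T (x : UnitAddCircle)‖) atTop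
      (𝓝 |deriv F x|) := by
  refine (tendsto_mul_abs_sub_of_hasDerivAt (h.hasDerivAt x)).congr' ?_
  have h1 : Tendsto (fun n : ℕ => |F (x + 1 / ((n : ℝ) + 1)) - F x|) atTop (𝓝 0) := by
    have : Tendsto (fun s : ℝ => |F (x + s) - F x|) (𝓝 0) (𝓝 |F (x + 0) - F x|) := by
      have := h.contDiff.continuous
      exact (by fun_prop : Continuous fun s : ℝ => |F (x + s) - F x|).tendsto 0
    simp only [add_zero, sub_self, abs_zero] at this
    exact this.comp tendsto_one_div_add_atTop_nhds_zero_nat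
  -- The circle norm agrees with the absolute value only up to half a period.
  filter_upwards [h1.eventually (gt_mem_nhds (by norm_num : (0 : ℝ) < 1 / 2))] with n hn
  rw [h.map_coe, h.map_coe, ← AddCircle.coe_sub, (AddCircle.norm_coe_eq_abs_iff _ one_ne_zero).2]
  simpa using hn.le

/-- Needed for `distortion` to be a true supremum: a real `⨆` over an unbounded family is `0`. -/
lemma IsC2Lift.bddAbove_distortion (h : IsC2Lift T F) :
    BddAbove (range fun x => |deriv (deriv F) x / deriv F x ^ 2|) := by
  obtain ⟨k, hk⟩ := h.exists_degree
  have p1 := periodic_deriv_of_add_one hk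
  have p2 := periodic_deriv p1
  have p : Periodic (fun x => |deriv (deriv F) x / deriv F x ^ 2|) 1 := fun x => by
    simp only [p1 x, p2 x]
  exact (p.compact_of_continuous one_ne_zero h.continuous_distortion).bddAbove

lemma bddBelow_dilation : BddBelow (range fun x => |deriv F x|) :=
  ⟨0, by rintro _ ⟨x, rfl⟩; exact abs_nonneg _⟩

lemma IsC2Lift.dilation_pos (h : IsC2Lift T F) : 0 < dilation F := by
  obtain ⟨k, hk⟩ := h.exists_degree
  have p1 := periodic_deriv_of_add_one hk
  have p : Periodic (fun x => |deriv F x|) 1 := fun x => by simp only [p1 x]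
  obtain ⟨y, ⟨x, rfl⟩, hx⟩ := (p.compact_of_continuous one_ne_zero
    h.contDiff_deriv.continuous.abs).exists_isLeast (range_nonempty _)
  refine (abs_pos.2 (h.deriv_ne_zero x)).trans_le (le_ciInf fun z => hx (mem_range_self z))

lemma IsC2Lift.abs_inv_deriv_le (h : IsC2Lift T F) (x : ℝ) :
    |(deriv F x)⁻¹| ≤ (dilation F)⁻¹ := by
  rw [abs_inv]
  exact inv_anti₀ h.dilation_pos (ciInf_le bddBelow_dilation x)

lemma IsC2Lift.abs_distortion_le (h : IsC2Lift T F) (x : ℝ) :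
    |deriv (deriv F) x / deriv F x ^ 2| ≤ distortion F :=
  le_ciSup h.bddAbove_distortion x

/-- Up to sign, `F'' / F'²` is the derivative of `1 / |F'|`, whose measurability is inherited from
that of `|F'|`. -/
lemma IsC2Lift.tendsto_distortion (h : IsC2Lift T F) (x : ℝ) :
    Tendsto (fun n : ℕ => ((n : ℝ) + 1) *
      |(|deriv F (x + 1 / ((n : ℝ) + 1))|)⁻¹ - (|deriv F x|)⁻¹|) atTop
      (𝓝 |deriv (deriv F) x / deriv F x ^ 2|) := by
  have h0 := h.deriv_ne_zero x
  have h1 : HasDerivAt (fun x => (|deriv F x|)⁻¹) _ x :=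
    ((hasDerivAt_abs h0).comp x (h.hasDerivAt_deriv x)).inv (abs_ne_zero.2 h0)
  convert tendsto_mul_abs_sub_of_hasDerivAt h1 using 2
  rw [abs_div, abs_div, abs_neg, abs_mul]
  rcases h0.lt_or_gt with h0 | h0 <;> simp [h0]

end

variable {Ω : Type*} [MeasurableSpace Ω] {η : Measure Ω}
    {T : Ω → UnitAddCircle → UnitAddCircle} {F : Ω → ℝ → ℝ}

lemma IsAdmissible.measurable_abs_deriv (hT : IsAdmissible η T F) (x : ℝ) :
    Measurable fun ω => |deriv (F ω) x| := by
  refine measurable_of_tendsto_metrizable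
    (f := fun (n : ℕ) ω => ((n : ℝ) + 1) * ‖T ω ((x + 1 / ((n : ℝ) + 1) : ℝ) : UnitAddCircle) -
      T ω (x : UnitAddCircle)‖) (fun n => ?_)
    (tendsto_pi_nhds.2 fun ω => (hT.isC2Lift ω).tendsto_mul_norm_sub x)
  have h1 : ∀ y : UnitAddCircle, Measurable fun ω => T ω y := fun y =>
    hT.measurable.comp (measurable_id.prodMk measurable_const)
  exact ((h1 _).sub (h1 _)).norm.const_mul _

lemma IsAdmissible.measurable_abs_distortion (hT : IsAdmissible η T F) (x : ℝ) :
    Measurable fun ω => |deriv (deriv (F ω)) x / deriv (F ω) x ^ 2| := by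
  refine measurable_of_tendsto_metrizable
    (f := fun (n : ℕ) ω => ((n : ℝ) + 1) * |(|deriv (F ω) (x + 1 / ((n : ℝ) + 1))|)⁻¹ -
      (|deriv (F ω) x|)⁻¹|) (fun n => ?_)
    (tendsto_pi_nhds.2 fun ω => (hT.isC2Lift ω).tendsto_distortion x)
  exact measurable_const.mul
    ((hT.measurable_abs_deriv _).inv.sub (hT.measurable_abs_deriv _).inv).norm

lemma IsAdmissible.measurable_dilation (hT : IsAdmissible η T F) :
    Measurable fun ω => dilation (F ω) := by
  refine measurable_of_Ici fun c => ?_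
  have : (fun ω => dilation (F ω)) ⁻¹' Ici c = ⋂ q : ℚ, {ω | c ≤ |deriv (F ω) q|} := by
    -- By continuity in `x`, the infimum is already decided by rational points, which leaves a
    -- countable intersection.
    ext ω
    simp only [mem_preimage, mem_Ici, mem_iInter, mem_ofPred_eq]
    refine ⟨fun h q => h.trans (ciInf_le bddBelow_dilation _), fun h => le_ciInf fun x => ?_⟩
    have hc : IsClosed {x | c ≤ |deriv (F ω) x|} :=
      isClosed_le continuous_const (hT.isC2Lift ω).contDiff_deriv.continuous.abs
    exact Rat.denseRange_cast.induction_on (p := fun x => c ≤ |deriv (F ω) x|) x hc h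
  rw [this]
  exact .iInter fun q => measurableSet_le measurable_const (hT.measurable_abs_deriv q)

lemma IsAdmissible.measurable_distortion (hT : IsAdmissible η T F) :
    Measurable fun ω => distortion (F ω) := by
  refine measurable_of_Iic fun c => ?_
  have : (fun ω => distortion (F ω)) ⁻¹' Iic c =
      ⋂ q : ℚ, {ω | |deriv (deriv (F ω)) q / deriv (F ω) q ^ 2| ≤ c} := by
    ext ω
    simp only [mem_preimage, mem_Iic, mem_iInter, mem_ofPred_eq]
    refine ⟨fun h q => ((hT.isC2Lift ω).abs_distortion_le _).trans h,
      fun h => ciSup_le fun x => ?_⟩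
    have hc : IsClosed {x | |deriv (deriv (F ω)) x / deriv (F ω) x ^ 2| ≤ c} :=
      isClosed_le (hT.isC2Lift ω).continuous_distortion continuous_const
    exact Rat.denseRange_cast.induction_on
      (p := fun x => |deriv (deriv (F ω)) x / deriv (F ω) x ^ 2| ≤ c) x hc h
  rw [this]
  exact .iInter fun q => measurableSet_le (hT.measurable_abs_distortion q) measurable_const

/-! ### The action of the chain on measures -/

section Step

variable {Ω Ω' : Type*} [MeasurableSpace Ω] [MeasurableSpace Ω']

/-- The law of `T ω x` when `ω ∼ η` and `x ∼ μ` are independent. -/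
noncomputable def step (η : Measure Ω) (T : Ω → UnitAddCircle → UnitAddCircle)
    (μ : Measure UnitAddCircle) : Measure UnitAddCircle :=
  (η.prod μ).map fun p => T p.1 p.2

variable {η : Measure Ω} {T : Ω → UnitAddCircle → UnitAddCircle} {μ ν : Measure UnitAddCircle}
  {η' : Measure Ω'} {T' : Ω' → UnitAddCircle → UnitAddCircle}

instance [IsFiniteMeasure η] [IsFiniteMeasure μ] : IsFiniteMeasure (step η T μ) := by
  unfold step; infer_instance

instance [SFinite η] [SFinite μ] : SFinite (step η T μ) := by
  unfold step; infer_instance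

lemma lintegral_step [SFinite η] [SFinite μ]
    (hT : Measurable fun p : Ω × UnitAddCircle => T p.1 p.2)
    {f : UnitAddCircle → ENNReal} (hf : Measurable f) :
    ∫⁻ x, f x ∂step η T μ = ∫⁻ ω, ∫⁻ x, f (T ω x) ∂μ ∂η := by
  rw [step, lintegral_map hf hT]
  exact lintegral_prod _ (hf.comp hT).aemeasurable

/-- Two independent steps are one step of the composed maps driven by product noise; this reduces
all iterates to one-step estimates. -/
lemma step_step [SFinite η] [SFinite η'] [SFinite μ]
    (hT : Measurable fun p : Ω × UnitAddCircle => T p.1 p.2)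
    (hT' : Measurable fun p : Ω' × UnitAddCircle => T' p.1 p.2) :
    step η T (step η' T' μ) = step (η.prod η') (fun p x => T p.1 (T' p.2 x)) μ := by
  have hTT : Measurable fun p : (Ω × Ω') × UnitAddCircle => T p.1.1 (T' p.1.2 p.2) :=
    hT.comp ((measurable_fst.comp measurable_fst).prodMk
      (hT'.comp ((measurable_snd.comp measurable_fst).prodMk measurable_snd)))
  refine Measure.ext_of_lintegral _ fun f hf => ?_
  rw [lintegral_step hT hf, lintegral_step hTT hf, lintegral_prod]
  · refine lintegral_congr fun ω => ?_
    exact lintegral_step hT' (hf.comp (hT.comp (measurable_const.prodMk measurable_id)))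
  · exact (Measurable.lintegral_prod_right' (hf.comp hTT)).aemeasurable

lemma integral_step [IsFiniteMeasure η] [IsFiniteMeasure μ]
    (hT : Measurable fun p : Ω × UnitAddCircle => T p.1 p.2)
    {f : UnitAddCircle → ℝ} (hf : Measurable f) {C : ℝ} (hC : ∀ x, |f x| ≤ C) :
    ∫ x, f x ∂step η T μ = ∫ ω, ∫ x, f (T ω x) ∂μ ∂η := by
  rw [step, integral_map hT.aemeasurable hf.aestronglyMeasurable, integral_prod]
  exact Integrable.of_bound (hf.comp hT).aestronglyMeasurable C (.of_forall fun p => hC _)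

/-- Duality between the action on measures and the Markov operator. -/
lemma integral_step_swap [IsFiniteMeasure η] [IsFiniteMeasure μ]
    (hT : Measurable fun p : Ω × UnitAddCircle => T p.1 p.2)
    {f : UnitAddCircle → ℝ} (hf : Measurable f) {C : ℝ} (hC : ∀ x, |f x| ≤ C) :
    ∫ x, f x ∂step η T μ = ∫ x, markovOp η T f x ∂μ := by
  rw [step, integral_map hT.aemeasurable hf.aestronglyMeasurable, integral_prod_symm]
  · rfl
  exact Integrable.of_bound (hf.comp hT).aestronglyMeasurable C (.of_forall fun p => hC _)

lemma step_add [SFinite η] [SFinite μ] [SFinite ν]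
    (hT : Measurable fun p : Ω × UnitAddCircle => T p.1 p.2) :
    step η T (μ + ν) = step η T μ + step η T ν := by
  rw [step, Measure.prod_add, Measure.map_add _ _ hT, step, step]

lemma step_smul [SFinite η] [SFinite μ] (c : ENNReal) :
    step η T (c • μ) = c • step η T μ := by
  rw [step, Measure.prod_smul_right, Measure.map_smul, step]

lemma step_mono [SFinite η] [SFinite μ] [SFinite ν]
    (hT : Measurable fun p : Ω × UnitAddCircle => T p.1 p.2) (h : μ ≤ ν) :
    step η T μ ≤ step η T ν := by
  refine Measure.le_iff.2 fun A hA => ?_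
  rw [← lintegral_indicator_one hA, ← lintegral_indicator_one hA,
    lintegral_step hT (measurable_one.indicator hA), lintegral_step hT (measurable_one.indicator hA)]
  exact lintegral_mono fun ω => lintegral_mono' h le_rfl

lemma step_absolutelyContinuous [SFinite η] [SFinite μ] [SFinite ν]
    (hT : Measurable fun p : Ω × UnitAddCircle => T p.1 p.2) (h : μ ≪ ν) :
    step η T μ ≪ step η T ν :=
  (Measure.AbsolutelyContinuous.rfl.prod h).map hT

lemma step_univ [IsProbabilityMeasure η] [SFinite μ]
    (hT : Measurable fun p : Ω × UnitAddCircle => T p.1 p.2) :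
    step η T μ univ = μ univ := by
  rw [step, Measure.map_apply hT .univ]
  simp [← univ_prod_univ]

instance isFiniteMeasure_iterate_step [IsFiniteMeasure η] [IsFiniteMeasure μ] (n : ℕ) :
    IsFiniteMeasure ((step η T)^[n] μ) := by
  induction n with
  | zero => assumption
  | succ n ih => rw [iterate_succ_apply']; infer_instance

lemma iterate_step_add [IsFiniteMeasure η] [IsFiniteMeasure μ] [IsFiniteMeasure ν]
    (hT : Measurable fun p : Ω × UnitAddCircle => T p.1 p.2) (n : ℕ) :
    (step η T)^[n] (μ + ν) = (step η T)^[n] μ + (step η T)^[n] ν := by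
  induction n with
  | zero => rfl
  | succ n ih => simp only [iterate_succ_apply', ih, step_add hT]

lemma iterate_step_mono [IsFiniteMeasure η] [IsFiniteMeasure μ] [IsFiniteMeasure ν]
    (hT : Measurable fun p : Ω × UnitAddCircle => T p.1 p.2) (h : μ ≤ ν) (n : ℕ) :
    (step η T)^[n] μ ≤ (step η T)^[n] ν := by
  induction n with
  | zero => exact h
  | succ n ih => simp only [iterate_succ_apply', step_mono hT ih]

lemma iterate_step_univ [IsProbabilityMeasure η] [IsFiniteMeasure μ]
    (hT : Measurable fun p : Ω × UnitAddCircle => T p.1 p.2) (n : ℕ) :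
    (step η T)^[n] μ univ = μ univ := by
  induction n with
  | zero => rfl
  | succ n ih => rw [iterate_succ_apply', step_univ hT, ih]

end Step

/-! ### Distortion of the iterates in mean square -/

/-- A random circle map with measurable, square integrable bounds `ℓ` for `1 / |T'|` and `a` for
the distortion. -/
structure IsControlled {Ω : Type*} [MeasurableSpace Ω] (η : Measure Ω)
    (T : Ω → UnitAddCircle → UnitAddCircle) (ℓ a : Ω → ℝ) : Prop where
  measurable : Measurable fun p : Ω × UnitAddCircle => T p.1 p.2
  measurable_inv : Measurable ℓ
  measurable_dist : Measurable a
  exists_lift : ∀ ω, ∃ F, IsC2Lift (T ω) F ∧ (∀ x, |(deriv F x)⁻¹| ≤ ℓ ω) ∧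
    ∀ x, |deriv (deriv F) x / deriv F x ^ 2| ≤ a ω
  integrable_inv : Integrable (fun ω => ℓ ω ^ 2) η
  integrable_dist : Integrable (fun ω => a ω ^ 2) η

namespace IsControlled

variable {Ω Ω' : Type*} [MeasurableSpace Ω] [MeasurableSpace Ω']
  {η : Measure Ω} {T : Ω → UnitAddCircle → UnitAddCircle} {ℓ a : Ω → ℝ}
  {η' : Measure Ω'} {T' : Ω' → UnitAddCircle → UnitAddCircle} {ℓ' a' : Ω' → ℝ}

lemma inv_nonneg (h : IsControlled η T ℓ a) (ω : Ω) : 0 ≤ ℓ ω := by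
  obtain ⟨F, -, h1, -⟩ := h.exists_lift ω
  exact (abs_nonneg _).trans (h1 0)

lemma dist_nonneg (h : IsControlled η T ℓ a) (ω : Ω) : 0 ≤ a ω := by
  obtain ⟨F, -, -, h1⟩ := h.exists_lift ω
  exact (abs_nonneg _).trans (h1 0)

end IsControlled

lemma IsC2Lift.comp {S S' : UnitAddCircle → UnitAddCircle} {F F' : ℝ → ℝ} (h : IsC2Lift S F)
    (h' : IsC2Lift S' F') : IsC2Lift (fun x => S (S' x)) (fun x => F (F' x)) where
  map_coe x := by rw [h'.map_coe, h.map_coe]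
  contDiff := h.contDiff.comp h'.contDiff
  deriv_ne_zero x := by
    have := (h.hasDerivAt (F' x)).comp x (h'.hasDerivAt x)
    rw [show (fun x => F (F' x)) = F ∘ F' from rfl, this.deriv]
    exact mul_ne_zero (h.deriv_ne_zero _) (h'.deriv_ne_zero _)

lemma IsC2Lift.deriv_comp {S S' : UnitAddCircle → UnitAddCircle} {F F' : ℝ → ℝ}
    (h : IsC2Lift S F) (h' : IsC2Lift S' F') :
    deriv (fun x => F (F' x)) = fun x => deriv F (F' x) * deriv F' x :=
  funext fun x => ((h.hasDerivAt (F' x)).comp x (h'.hasDerivAt x)).deriv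

/-- Cocycle rule for `F'' / F'²`: the contribution of the inner map is damped by the contraction `1
/ F'` of the outer one. -/
lemma IsC2Lift.deriv_deriv_comp_div {S S' : UnitAddCircle → UnitAddCircle} {F F' : ℝ → ℝ}
    (h : IsC2Lift S F) (h' : IsC2Lift S' F') (x : ℝ) :
    deriv (deriv (fun x => F (F' x))) x / deriv (fun x => F (F' x)) x ^ 2 =
      deriv (deriv F) (F' x) / deriv F (F' x) ^ 2 +
        (deriv F (F' x))⁻¹ * (deriv (deriv F') x / deriv F' x ^ 2) := by
  rw [h.deriv_comp h']
  have e : HasDerivAt (fun x => deriv F (F' x) * deriv F' x) _ x :=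
    ((h.hasDerivAt_deriv (F' x)).comp x (h'.hasDerivAt x)).mul (h'.hasDerivAt_deriv x)
  rw [e.deriv]
  have h1 := h.deriv_ne_zero (F' x)
  have h2 := h'.deriv_ne_zero x
  simp only [comp_apply]
  field_simp

lemma sq_add_le {s : ℝ} (hs : 0 < s) (x y : ℝ) :
    (x + y) ^ 2 ≤ (1 + s⁻¹) * x ^ 2 + (1 + s) * y ^ 2 := by
  have h1 : 0 ≤ s⁻¹ * (x - s * y) ^ 2 := by positivity
  have h2 : s⁻¹ * (x - s * y) ^ 2 = s⁻¹ * x ^ 2 - 2 * x * y + s * y ^ 2 := by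
    field_simp
    ring
  nlinarith

namespace IsControlled

section

variable {Ω Ω' : Type*} [MeasurableSpace Ω] [MeasurableSpace Ω']
  {η : Measure Ω} {T : Ω → UnitAddCircle → UnitAddCircle} {ℓ a : Ω → ℝ}
  {η' : Measure Ω'} {T' : Ω' → UnitAddCircle → UnitAddCircle} {ℓ' a' : Ω' → ℝ}
  [IsProbabilityMeasure η']

lemma integrable_sq_add (h : IsControlled η T ℓ a) (h' : IsControlled η' T' ℓ' a') (s : ℝ) :
    Integrable (fun p : Ω × Ω' => (1 + s⁻¹) * a p.1 ^ 2 + (1 + s) * (ℓ p.1 ^ 2 * a' p.2 ^ 2))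
      (η.prod η') :=
  ((h.integrable_dist.comp_fst _).const_mul _).add
    ((h.integrable_inv.mul_prod h'.integrable_dist).const_mul _)

lemma comp (h : IsControlled η T ℓ a) (h' : IsControlled η' T' ℓ' a') :
    IsControlled (η.prod η') (fun p x => T p.1 (T' p.2 x)) (fun p => ℓ p.1 * ℓ' p.2)
      (fun p => a p.1 + ℓ p.1 * a' p.2) where
  measurable := h.measurable.comp ((measurable_fst.comp measurable_fst).prodMk
      (h'.measurable.comp ((measurable_snd.comp measurable_fst).prodMk measurable_snd)))
  measurable_inv := (h.measurable_inv.comp measurable_fst).mul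
    (h'.measurable_inv.comp measurable_snd)
  measurable_dist := (h.measurable_dist.comp measurable_fst).add
    ((h.measurable_inv.comp measurable_fst).mul (h'.measurable_dist.comp measurable_snd))
  exists_lift p := by
    obtain ⟨F, hF, hF1, hF2⟩ := h.exists_lift p.1
    obtain ⟨F', hF', hF1', hF2'⟩ := h'.exists_lift p.2
    refine ⟨_, hF.comp hF', fun x => ?_, fun x => ?_⟩
    · rw [hF.deriv_comp hF', mul_inv, abs_mul]
      exact mul_le_mul (hF1 _) (hF1' _) (abs_nonneg _) (h.inv_nonneg _)
    · rw [hF.deriv_deriv_comp_div hF']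
      refine (abs_add_le _ _).trans (add_le_add (hF2 _) ?_)
      rw [abs_mul]
      exact mul_le_mul (hF1 _) (hF2' _) (abs_nonneg _) (h.inv_nonneg _)
  integrable_inv := by
    simp_rw [mul_pow]
    exact h.integrable_inv.mul_prod h'.integrable_inv
  integrable_dist := by
    refine (h.integrable_sq_add h' 1).mono' ?_ (.of_forall fun p => ?_)
    · exact (((h.measurable_dist.comp measurable_fst).add
        ((h.measurable_inv.comp measurable_fst).mul
          (h'.measurable_dist.comp measurable_snd))).pow_const 2).aestronglyMeasurable
    · rw [Real.norm_of_nonneg (sq_nonneg _), ← mul_pow]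
      exact sq_add_le one_pos _ _

variable [IsProbabilityMeasure η]

lemma integral_sq_dist_comp_le (h : IsControlled η T ℓ a) (h' : IsControlled η' T' ℓ' a')
    {s : ℝ} (hs : 0 < s) :
    ∫ p : Ω × Ω', (a p.1 + ℓ p.1 * a' p.2) ^ 2 ∂(η.prod η') ≤
      (1 + s⁻¹) * (∫ ω, a ω ^ 2 ∂η) + (1 + s) * ((∫ ω, ℓ ω ^ 2 ∂η) * ∫ ω, a' ω ^ 2 ∂η') := by
  calc _ ≤ ∫ p : Ω × Ω', ((1 + s⁻¹) * a p.1 ^ 2 + (1 + s) * (ℓ p.1 ^ 2 * a' p.2 ^ 2))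
        ∂(η.prod η') := by
        refine integral_mono (h.comp h').integrable_dist (h.integrable_sq_add h' s) fun p => ?_
        simp only [← mul_pow]
        exact sq_add_le hs _ _
    _ = _ := by
        rw [integral_add ((h.integrable_dist.comp_fst _).const_mul _)
          ((h.integrable_inv.mul_prod h'.integrable_dist).const_mul _), integral_const_mul,
          integral_const_mul, integral_prod_mul (fun ω => ℓ ω ^ 2) (fun ω => a' ω ^ 2),
          integral_fun_fst (fun ω => a ω ^ 2)]
        simp

end

variable {Ω : Type u} [MeasurableSpace Ω] {η : Measure Ω} [IsProbabilityMeasure η]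
  {T : Ω → UnitAddCircle → UnitAddCircle} {ℓ a : Ω → ℝ}

/-- The iterates of a random circle map that contracts in mean square have uniformly square
integrable distortion. -/
theorem exists_iterate (h : IsControlled η T ℓ a) (hq : ∫ ω, ℓ ω ^ 2 ∂η < 1) :
    ∃ K : ℝ, 0 ≤ K ∧ ∀ n : ℕ, ∃ (Ω' : Type u) (_ : MeasurableSpace Ω') (η' : Measure Ω')
      (_ : IsProbabilityMeasure η') (T' : Ω' → UnitAddCircle → UnitAddCircle) (ℓ' a' : Ω' → ℝ),
      IsControlled η' T' ℓ' a' ∧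
      (∀ (μ : Measure UnitAddCircle) [SFinite μ], (step η T)^[n] μ = step η' T' μ) ∧
      ∫ ω, ℓ' ω ^ 2 ∂η' ≤ (∫ ω, ℓ ω ^ 2 ∂η) ^ n ∧ ∫ ω, a' ω ^ 2 ∂η' ≤ K := by
  set q := ∫ ω, ℓ ω ^ 2 ∂η with hq_def
  set B := ∫ ω, a ω ^ 2 ∂η with hB_def
  have hq0 : 0 ≤ q := integral_nonneg fun ω => sq_nonneg _
  have hB0 : 0 ≤ B := integral_nonneg fun ω => sq_nonneg _
  -- With this `s`, `(1 + s) q ≤ 1 - s`, because `(1 - q)² ≥ 0`. Hence `K` is a barrier for the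
  -- recursion: `(1 + s⁻¹) B + (1 + s) q K ≤ s K + (1 - s) K = K`.
  set s := (1 - q) / 2 with hs_def
  have hs : 0 < s := by linarith
  set K := (1 + s⁻¹) * B / s with hK
  have hK0 : 0 ≤ K := by positivity
  have hKs : s * K = (1 + s⁻¹) * B := by rw [hK]; field_simp
  refine ⟨K, hK0, fun n => ?_⟩
  induction n with
  | zero =>
    refine ⟨PUnit, inferInstance, Measure.dirac PUnit.unit, inferInstance, fun _ x => x,
      fun _ => 1, fun _ => 0, ⟨measurable_snd, measurable_const, measurable_const, fun ω => ?_,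
        by simp, by simp⟩, fun μ _ => ?_, by simp, by simpa using hK0⟩
    · refine ⟨id, ⟨fun x => rfl, contDiff_id, by simp⟩, by simp, fun x => ?_⟩
      have : deriv (id : ℝ → ℝ) = fun _ => 1 := deriv_id'
      simp [this]
    · rw [iterate_zero, id, step, Measure.dirac_prod, Measure.map_map measurable_snd (by fun_prop)]
      exact Measure.map_id.symm
  | succ n ih =>
    obtain ⟨Ω', _, η', _, T', ℓ', a', h', hstep, hℓ', ha'⟩ := ih
    -- The new map is the outer one, so the old distortion is multiplied by an independent `ℓ`,
    -- whose second moment is `q`.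
    refine ⟨Ω × Ω', inferInstance, η.prod η', inferInstance, _, _, _, h.comp h',
      fun μ _ => ?_, ?_, ?_⟩
    · rw [iterate_succ_apply', hstep μ, step_step h.measurable h'.measurable]
    · simp_rw [mul_pow]
      rw [integral_prod_mul (fun ω => ℓ ω ^ 2) (fun ω => ℓ' ω ^ 2), pow_succ']
      exact mul_le_mul_of_nonneg_left hℓ' hq0
    · refine (h.integral_sq_dist_comp_le h' hs).trans ?_
      rw [← hB_def, ← hKs, ← hq_def]
      have h1 : (1 + s) * (q * ∫ ω, a' ω ^ 2 ∂η') ≤ (1 + s) * (q * K) :=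
        mul_le_mul_of_nonneg_left (mul_le_mul_of_nonneg_left ha' hq0) (by linarith)
      have h2 : (1 + s) * q ≤ 1 - s := by rw [hs_def]; nlinarith
      nlinarith

end IsControlled

lemma IsAdmissible.isControlled {Ω : Type*} [MeasurableSpace Ω] {η : Measure Ω}
    {T : Ω → UnitAddCircle → UnitAddCircle} {F : Ω → ℝ → ℝ} (hT : IsAdmissible η T F) :
    IsControlled η T (fun ω => (dilation (F ω))⁻¹) (fun ω => distortion (F ω)) where
  measurable := hT.measurable
  measurable_inv := hT.measurable_dilation.inv
  measurable_dist := hT.measurable_distortion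
  exists_lift ω := ⟨F ω, hT.isC2Lift ω, (hT.isC2Lift ω).abs_inv_deriv_le,
    (hT.isC2Lift ω).abs_distortion_le⟩
  integrable_inv := by
    simp_rw [inv_pow]
    refine ⟨(hT.measurable_dilation.pow_const 2).inv.aestronglyMeasurable, ?_⟩
    rw [hasFiniteIntegral_iff_ofReal (.of_forall fun ω => by positivity)]
    exact hT.dilation_moment.trans ENNReal.one_lt_top
  integrable_dist := by
    refine ⟨(hT.measurable_distortion.pow_const 2).aestronglyMeasurable, ?_⟩
    rw [hasFiniteIntegral_iff_ofReal (.of_forall fun ω => by positivity)]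
    exact hT.distortion_moment

lemma IsAdmissible.integral_sq_inv_lt_one {Ω : Type*} [MeasurableSpace Ω] {η : Measure Ω}
    {T : Ω → UnitAddCircle → UnitAddCircle} {F : Ω → ℝ → ℝ} (hT : IsAdmissible η T F) :
    ∫ ω, ((dilation (F ω))⁻¹) ^ 2 ∂η < 1 := by
  simp_rw [inv_pow]
  have hm : Measurable fun ω => (dilation (F ω) ^ 2)⁻¹ := (hT.measurable_dilation.pow_const 2).inv
  rw [integral_eq_lintegral_of_nonneg_ae (.of_forall fun ω => by positivity)
    hm.aestronglyMeasurable]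
  exact (ENNReal.toReal_lt_toReal (hT.dilation_moment.trans ENNReal.one_lt_top).ne
    ENNReal.one_ne_top).2 hT.dilation_moment

/-! ### Measures with densities and uniform bounds on the laws -/

instance : IsProbabilityMeasure (volume : Measure UnitAddCircle) := ⟨UnitAddCircle.measure_univ⟩

lemma integrable_of_continuous {f : UnitAddCircle → ℝ} (hf : Continuous f)
    (μ : Measure UnitAddCircle) [IsFiniteMeasure μ] : Integrable f μ :=
  hf.integrable_of_hasCompactSupport (HasCompactSupport.of_compactSpace f)

lemma exists_abs_le_of_continuous {f : UnitAddCircle → ℝ} (hf : Continuous f) :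
    ∃ C, ∀ x, |f x| ≤ C := by
  obtain ⟨C, hC⟩ := (isCompact_range hf).isBounded.exists_norm_le
  exact ⟨C, fun x => hC _ (mem_range_self x)⟩

/-- The measure with density `h` with respect to Lebesgue measure. -/
noncomputable abbrev densityMeasure (h : UnitAddCircle → ℝ) : Measure UnitAddCircle :=
  (volume : Measure UnitAddCircle).withDensity fun x => ENNReal.ofReal (h x)

lemma isFiniteMeasure_densityMeasure {h : UnitAddCircle → ℝ} (hh : Integrable h) :
    IsFiniteMeasure (densityMeasure h) :=
  isFiniteMeasure_withDensity_ofReal hh.2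

lemma integral_densityMeasure {h : UnitAddCircle → ℝ} (hh : Measurable h) (h0 : ∀ x, 0 ≤ h x)
    (f : UnitAddCircle → ℝ) : ∫ x, f x ∂densityMeasure h = ∫ x, f x * h x := by
  rw [integral_withDensity_eq_integral_toReal_smul hh.ennreal_ofReal (by simp)]
  simp_rw [ENNReal.toReal_ofReal (h0 _), smul_eq_mul, mul_comm]

/-- Finite measures on the circle are compared through continuous test functions. -/
lemma measure_le_of_integral_le {μ ν : Measure UnitAddCircle} [IsFiniteMeasure μ]
    [IsFiniteMeasure ν]
    (h : ∀ f : UnitAddCircle → ℝ, Continuous f → (∀ x, 0 ≤ f x) → ∫ x, f x ∂μ ≤ ∫ x, f x ∂ν) :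
    μ ≤ ν := by
  -- Closed sets are reached by thickened indicators, and all measurable sets then follow by inner
  -- regularity.
  have hclosed : ∀ C : Set UnitAddCircle, IsClosed C → μ C ≤ ν C := by
    intro C hC
    have hp : ∀ n : ℕ, 0 < 1 / ((n : ℝ) + 1) := fun n => Nat.one_div_pos_of_nat
    have t1 := tendsto_integral_thickenedIndicator_of_isClosed μ hC hp
      tendsto_one_div_add_atTop_nhds_zero_nat
    have t2 := tendsto_integral_thickenedIndicator_of_isClosed ν hC hp
      tendsto_one_div_add_atTop_nhds_zero_nat
    have := le_of_tendsto_of_tendsto' t1 t2 fun n => h _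
      (NNReal.continuous_coe.comp (thickenedIndicator (hp n) C).continuous) fun x => by positivity
    exact (ENNReal.toReal_le_toReal (measure_ne_top _ _) (measure_ne_top _ _)).1 this
  refine Measure.le_iff.2 fun A hA => ?_
  rw [hA.measure_eq_iSup_isClosed_of_ne_top (measure_ne_top μ A)]
  exact iSup_le fun C => iSup_le fun hCA => iSup_le fun hC => (hclosed C hC).trans (measure_mono hCA)

/-- Jensen's inequality for `exp (-·)`, obtained from the tangent line at `M`. -/
lemma exp_neg_le_integral_exp_neg {Ω : Type*} [MeasurableSpace Ω] {η : Measure Ω}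
    [IsProbabilityMeasure η] {σ : Ω → ℝ} (hσ : Measurable σ) (h0 : ∀ ω, 0 ≤ σ ω)
    (hi : Integrable σ η) {M : ℝ} (hM : ∫ ω, σ ω ∂η ≤ M) :
    Integrable (fun ω => Real.exp (-σ ω)) η ∧ Real.exp (-M) ≤ ∫ ω, Real.exp (-σ ω) ∂η := by
  have hint : Integrable (fun ω => Real.exp (-σ ω)) η :=
    Integrable.of_bound hσ.neg.exp.aestronglyMeasurable 1 (.of_forall fun ω => by
      rw [Real.norm_of_nonneg (Real.exp_pos _).le]
      exact Real.exp_le_one_iff.2 (neg_nonpos.2 (h0 ω)))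
  refine ⟨hint, ?_⟩
  have hlin : Integrable (fun ω => Real.exp (-M) * ((1 + M) - σ ω)) η :=
    ((integrable_const _).sub hi).const_mul _
  calc Real.exp (-M) ≤ Real.exp (-M) * ((1 + M) - ∫ ω, σ ω ∂η) :=
        le_mul_of_one_le_right (Real.exp_pos _).le (by linarith)
    _ = ∫ ω, Real.exp (-M) * ((1 + M) - σ ω) ∂η := by
        rw [integral_const_mul, integral_sub (integrable_const _) hi]
        simp
    _ ≤ _ := integral_mono hlin hint fun ω => by
        have h1 := Real.add_one_le_exp (M - σ ω)
        calc Real.exp (-M) * ((1 + M) - σ ω) ≤ Real.exp (-M) * Real.exp (M - σ ω) :=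
              mul_le_mul_of_nonneg_left (by linarith) (Real.exp_pos _).le
          _ = _ := by rw [← Real.exp_add]; ring_nf

namespace IsControlled

section

variable {Ω : Type*} [MeasurableSpace Ω] {η : Measure Ω} [IsProbabilityMeasure η]
  {T : Ω → UnitAddCircle → UnitAddCircle} {ℓ a : Ω → ℝ} {φ h : UnitAddCircle → ℝ}

lemma integrable_integral_comp (H : IsControlled η T ℓ a) (hφ : Continuous φ)
    (μ : Measure UnitAddCircle) [IsFiniteMeasure μ] :
    Integrable (fun ω => ∫ x, φ (T ω x) ∂μ) η := by
  obtain ⟨C, hC⟩ := exists_abs_le_of_continuous hφ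
  exact (Integrable.of_bound (f := fun p : Ω × UnitAddCircle => φ (T p.1 p.2)) (μ := η.prod μ)
    (hφ.measurable.comp H.measurable).aestronglyMeasurable C
    (.of_forall fun p => hC _)).integral_prod_left

lemma integrable_bound (H : IsControlled η T ℓ a) (ρ : ℝ) :
    Integrable (fun ω => ρ * ℓ ω + a ω) η := by
  have h1 : MemLp ℓ 2 η := (memLp_two_iff_integrable_sq
    H.measurable_inv.aestronglyMeasurable).2 H.integrable_inv
  have h2 : MemLp a 2 η := (memLp_two_iff_integrable_sq
    H.measurable_dist.aestronglyMeasurable).2 H.integrable_dist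
  exact ((h1.integrable one_le_two).const_mul ρ).add (h2.integrable one_le_two)

lemma integral_bound_le (H : IsControlled η T ℓ a) {ρ K : ℝ}
    (hρ : ρ ^ 2 * ∫ ω, ℓ ω ^ 2 ∂η ≤ 1) (hK : ∫ ω, a ω ^ 2 ∂η ≤ K) :
    ∫ ω, (ρ * ℓ ω + a ω) ∂η ≤ 2 + K := by
  have hi : Integrable (fun ω => ρ ^ 2 * ℓ ω ^ 2 + a ω ^ 2) η :=
    (H.integrable_inv.const_mul _).add H.integrable_dist
  calc _ ≤ ∫ ω, (1 + (ρ ^ 2 * ℓ ω ^ 2 + a ω ^ 2)) ∂η := by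
        refine integral_mono (H.integrable_bound ρ) ((integrable_const _).add hi) fun ω => ?_
        -- Both terms satisfy `y ≤ y² + 1/4`.
        nlinarith [sq_nonneg (ρ * ℓ ω - 1 / 2), sq_nonneg (a ω - 1 / 2)]
    _ = 1 + (ρ ^ 2 * (∫ ω, ℓ ω ^ 2 ∂η) + ∫ ω, a ω ^ 2 ∂η) := by
        rw [integral_add (integrable_const _) hi,
          integral_add (H.integrable_inv.const_mul _) H.integrable_dist, integral_const_mul]
        simp
    _ ≤ _ := by linarith

/-- One step of the chain spreads a log-Lipschitz density over the whole circle. -/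
lemma exp_mul_le_integral_step (H : IsControlled η T ℓ a) {ρ K : ℝ} (hρ0 : 0 ≤ ρ)
    (hρ1 : ρ ^ 2 * ∫ ω, ℓ ω ^ 2 ∂η ≤ 1) (hK : ∫ ω, a ω ^ 2 ∂η ≤ K)
    (hφ : Continuous φ) (hφ0 : ∀ x, 0 ≤ φ x)
    (hh : ContDiff ℝ 1 fun x : ℝ => h x) (hh0 : ∀ x, 0 ≤ h x)
    (hρ : ∀ x : ℝ, |deriv (fun y : ℝ => h y) x| ≤ ρ * h x) :
    Real.exp (-(2 + K)) * ((∫ x, φ x) * ∫ x, h x) ≤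
      ∫ x, φ x ∂step η T (densityMeasure h) := by
  have hhc := continuous_of_contDiff_comp_coe hh
  have := isFiniteMeasure_densityMeasure (integrable_of_continuous hhc volume)
  obtain ⟨C, hC⟩ := exists_abs_le_of_continuous hφ
  rw [integral_step H.measurable hφ.measurable hC]
  obtain ⟨hi, hexp⟩ := exp_neg_le_integral_exp_neg
    ((H.measurable_inv.const_mul ρ).add H.measurable_dist)
    (fun ω => add_nonneg (mul_nonneg hρ0 (H.inv_nonneg ω)) (H.dist_nonneg ω))
    (H.integrable_bound ρ) (H.integral_bound_le hρ1 hK)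
  have h0 : 0 ≤ (∫ x, φ x) * ∫ x, h x := mul_nonneg (integral_nonneg hφ0) (integral_nonneg hh0)
  refine (mul_le_mul_of_nonneg_right hexp h0).trans ?_
  rw [← integral_mul_const]
  refine integral_mono (hi.mul_const _) (H.integrable_integral_comp hφ _) fun ω => ?_
  obtain ⟨F, hF, h1, h2⟩ := H.exists_lift ω
  rw [integral_densityMeasure hhc.measurable hh0]
  exact exp_mul_integral_le hF h1 h2 hφ hφ0 hh hh0 hρ0 hρ

lemma integral_step_sub_le (H : IsControlled η T ℓ a) {K : ℝ} (hK : ∫ ω, a ω ^ 2 ∂η ≤ K)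
    (hφ : Continuous φ) (hφ0 : ∀ x, 0 ≤ φ x) (t : UnitAddCircle) :
    (∫ x, φ x ∂step η T volume) - ∫ x, φ (x + t) ∂step η T volume ≤
      Real.exp 1 * (1 + 2 * K) * ‖t‖ * ∫ x, φ x := by
  obtain ⟨C, hC⟩ := exists_abs_le_of_continuous hφ
  have hφt : Continuous fun x => φ (x + t) := by fun_prop
  rw [integral_step H.measurable hφ.measurable hC,
    integral_step H.measurable hφt.measurable (fun x => hC (x + t)),
    ← integral_sub (H.integrable_integral_comp hφ _) (H.integrable_integral_comp hφt _)]
  have h0 : 0 ≤ ‖t‖ * ∫ x, φ x := mul_nonneg (norm_nonneg _) (integral_nonneg hφ0)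
  have hi : Integrable (fun ω => Real.exp 1 * (1 + 2 * a ω ^ 2) * (‖t‖ * ∫ x, φ x)) η :=
    (((integrable_const _).add (H.integrable_dist.const_mul 2)).const_mul _).mul_const _
  calc _ ≤ ∫ ω, Real.exp 1 * (1 + 2 * a ω ^ 2) * (‖t‖ * ∫ x, φ x) ∂η := by
        refine integral_mono ((H.integrable_integral_comp hφ _).sub
          (H.integrable_integral_comp hφt _)) hi fun ω => ?_
        obtain ⟨F, hF, h1, h2⟩ := H.exists_lift ω
        refine (integral_sub_le hF h1 h2 hφ hφ0 t).trans ?_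
        rw [mul_assoc (_ * _)]
        refine mul_le_mul_of_nonneg_right (mul_le_mul_of_nonneg_left ?_ (Real.exp_pos _).le) h0
        nlinarith [sq_nonneg (a ω - 1 / 2)]
    _ = Real.exp 1 * (1 + 2 * ∫ ω, a ω ^ 2 ∂η) * (‖t‖ * ∫ x, φ x) := by
        rw [integral_mul_const, integral_const_mul, integral_add (integrable_const _)
          (H.integrable_dist.const_mul 2), integral_const_mul]
        simp
    _ ≤ Real.exp 1 * (1 + 2 * K) * (‖t‖ * ∫ x, φ x) := by
        refine mul_le_mul_of_nonneg_right (mul_le_mul_of_nonneg_left ?_ (Real.exp_pos _).le) h0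
        linarith
    _ = _ := by ring

end

lemma exists_log_deriv_bound {h : UnitAddCircle → ℝ} (hh : ContDiff ℝ 1 fun x : ℝ => h x)
    (hh0 : ∀ x, 0 < h x) :
    ∃ ρ : ℝ, 0 ≤ ρ ∧ ∀ x : ℝ, |deriv (fun y : ℝ => h y) x| ≤ ρ * h x := by
  have hd := hh.continuous_deriv le_rfl
  have hp := periodic_deriv (periodic_comp_coe h)
  have hc : Continuous fun x : ℝ => deriv (fun y : ℝ => h y) x / h x :=
    hd.div hh.continuous fun x => (hh0 x).ne'
  have hper : Periodic (fun x : ℝ => deriv (fun y : ℝ => h y) x / h x) 1 := fun x => by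
    have := periodic_comp_coe h x
    simp only at this
    simp only [hp x, this]
  obtain ⟨ρ, hρ⟩ := (hper.isBounded_of_continuous one_ne_zero hc).exists_norm_le
  have hρ' : ∀ x : ℝ, |deriv (fun y : ℝ => h y) x / h x| ≤ ρ := fun x => hρ _ (mem_range_self x)
  refine ⟨ρ, (abs_nonneg _).trans (hρ' 0), fun x => ?_⟩
  have := hρ' x
  rwa [abs_div, abs_of_pos (hh0 x), div_le_iff₀ (hh0 x)] at this

variable {Ω : Type u} [MeasurableSpace Ω] {η : Measure Ω} [IsProbabilityMeasure η]
  {T : Ω → UnitAddCircle → UnitAddCircle} {ℓ a : Ω → ℝ}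

/-- Uniform bounds for the laws of a chain that contracts in mean square: started from Lebesgue
measure, the laws are uniformly Lipschitz and bounded below; started from a positive `C¹` density,
the law is eventually bounded below by a constant that does not depend on that density. -/
theorem exists_uniform_bounds (H : IsControlled η T ℓ a) (hq : ∫ ω, ℓ ω ^ 2 ∂η < 1) :
    ∃ c L : ℝ, 0 < c ∧ 0 ≤ L ∧
      (∀ (n : ℕ) (φ : UnitAddCircle → ℝ), Continuous φ → (∀ x, 0 ≤ φ x) →
        c * ∫ x, φ x ≤ ∫ x, φ x ∂(step η T)^[n] volume) ∧
      (∀ (n : ℕ) (φ : UnitAddCircle → ℝ), Continuous φ → (∀ x, 0 ≤ φ x) → ∀ t : UnitAddCircle,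
        (∫ x, φ x ∂(step η T)^[n] volume) - ∫ x, φ (x + t) ∂(step η T)^[n] volume ≤
          L * ‖t‖ * ∫ x, φ x) ∧
      ∀ h : UnitAddCircle → ℝ, ContDiff ℝ 1 (fun x : ℝ => h x) → (∀ x, 0 < h x) →
        ∃ n : ℕ, ∀ φ : UnitAddCircle → ℝ, Continuous φ → (∀ x, 0 ≤ φ x) →
          c * ((∫ x, φ x) * ∫ x, h x) ≤ ∫ x, φ x ∂(step η T)^[n] (densityMeasure h) := by
  obtain ⟨K, hK0, hK⟩ := H.exists_iterate hq
  have hq0 : 0 ≤ ∫ ω, ℓ ω ^ 2 ∂η := integral_nonneg fun ω => sq_nonneg _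
  -- Here `2 + K` bounds the mean of `ρ ℓ + a` once `ρ² ∫ ℓ² ≤ 1`, and `1 + 2 K` bounds the mean of
  -- `a (1 + a)`.
  refine ⟨Real.exp (-(2 + K)), Real.exp 1 * (1 + 2 * K), Real.exp_pos _, by positivity,
    fun n φ hφ hφ0 => ?_, fun n φ hφ hφ0 t => ?_, fun h hh hh0 => ?_⟩
  · obtain ⟨Ω', _, η', _, T', ℓ', a', H', hstep, hℓ', ha'⟩ := hK n
    have := H'.exp_mul_le_integral_step (h := fun _ => 1) (ρ := 0) le_rfl (by simp) ha' hφ hφ0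
      contDiff_const (by simp) (by simp)
    rw [hstep volume]
    simpa [densityMeasure] using this
  · obtain ⟨Ω', _, η', _, T', ℓ', a', H', hstep, hℓ', ha'⟩ := hK n
    rw [hstep volume]
    exact H'.integral_step_sub_le ha' hφ hφ0 t
  · obtain ⟨ρ, hρ0, hρ⟩ := exists_log_deriv_bound hh hh0
    -- The time `n` depends on the log-Lipschitz constant `ρ` of the initial density; the resulting
    -- lower bound does not.
    have ht : Tendsto (fun n : ℕ => ρ ^ 2 * (∫ ω, ℓ ω ^ 2 ∂η) ^ n) atTop (𝓝 (ρ ^ 2 * 0)) :=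
      (tendsto_pow_atTop_nhds_zero_of_lt_one hq0 hq).const_mul _
    rw [mul_zero] at ht
    obtain ⟨n, hn⟩ := (ht.eventually (gt_mem_nhds one_pos)).exists
    refine ⟨n, fun φ hφ hφ0 => ?_⟩
    obtain ⟨Ω', _, η', _, T', ℓ', a', H', hstep, hℓ', ha'⟩ := hK n
    have := isFiniteMeasure_densityMeasure
      (integrable_of_continuous (continuous_of_contDiff_comp_coe hh) volume)
    rw [hstep]
    exact H'.exp_mul_le_integral_step hρ0
      ((mul_le_mul_of_nonneg_left hℓ' (sq_nonneg _)).trans hn.le) ha' hφ hφ0 hh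
      (fun x => (hh0 x).le) hρ

end IsControlled

/-! ### Minorization and uniqueness -/

section Spreading

variable {Ω : Type*} [MeasurableSpace Ω] {η : Measure Ω} [IsProbabilityMeasure η]
  {T : Ω → UnitAddCircle → UnitAddCircle} {c : ℝ}

/-- Positive `C¹` densities are eventually spread over the circle, with a uniform constant `c`. -/
structure IsSpreading (η : Measure Ω) (T : Ω → UnitAddCircle → UnitAddCircle) (c : ℝ) : Prop where
  measurable : Measurable fun p : Ω × UnitAddCircle => T p.1 p.2
  pos : 0 < c
  exists_le : ∀ h : UnitAddCircle → ℝ, ContDiff ℝ 1 (fun x : ℝ => h x) → (∀ x, 0 < h x) →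
    ∃ n : ℕ, ∀ φ : UnitAddCircle → ℝ, Continuous φ → (∀ x, 0 ≤ φ x) →
      c * ((∫ x, φ x) * ∫ x, h x) ≤ ∫ x, φ x ∂(step η T)^[n] (densityMeasure h)

lemma exists_contDiff_pos_integral_sub_le {f : UnitAddCircle → ℝ} (hf : Integrable f)
    (hf0 : ∀ x, 0 ≤ f x) {ε : ℝ} (hε : 0 < ε) :
    ∃ h : UnitAddCircle → ℝ, ContDiff ℝ 1 (fun x : ℝ => h x) ∧ (∀ x, 0 < h x) ∧
      ∫ x, |f x - h x| ≤ ε := by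
  have hε3 : 0 < ε / 3 := by linarith
  obtain ⟨g, hg, hgi⟩ := hf.exists_boundedContinuous_integral_sub_le hε3
  have hgc : Continuous fun x => max (g x) 0 := g.continuous.max continuous_const
  obtain ⟨k, hk1, hk2, hk3⟩ := exists_contDiff_approx hgc hε3
  have hk3 := hk3 fun x => le_max_right _ _
  -- The shift makes the density strictly positive; truncation at `0` costs nothing because `f ≥ 0`.
  refine ⟨fun x => k x + ε / 3, hk1.add contDiff_const, fun x => by linarith [hk3 x], ?_⟩
  have hhi : Integrable (fun x => k x + ε / 3) := integrable_of_continuous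
    ((continuous_of_contDiff_comp_coe hk1).add continuous_const) _
  calc ∫ x, |f x - (k x + ε / 3)| ≤ ∫ x, (‖f x - g x‖ + 2 * (ε / 3)) := by
        refine integral_mono (hf.sub hhi).abs ((hf.sub hgi).norm.add (integrable_const _))
          fun x => ?_
        have h1 : |f x - max (g x) 0| ≤ |f x - g x| := by
          simpa [max_eq_left (hf0 x)] using abs_max_sub_max_le_abs (f x) (g x) 0
        have h2 := hk2 x
        rw [Real.norm_eq_abs]
        rw [abs_le] at *
        constructor <;> linarith [h1.1, h1.2, h2.1, h2.2]
    _ = (∫ x, ‖f x - g x‖) + 2 * (ε / 3) := by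
        have := integral_add (hf.sub hgi).norm
          (integrable_const (μ := (volume : Measure UnitAddCircle)) (2 * (ε / 3)))
        simpa using this
    _ ≤ ε := by linarith

namespace IsSpreading

lemma smul_volume_le_iterate (H : IsSpreading η T c) {h : UnitAddCircle → ℝ}
    (hh : ContDiff ℝ 1 fun x : ℝ => h x) (hh0 : ∀ x, 0 < h x) :
    ∃ n : ℕ, (ENNReal.ofReal c * densityMeasure h univ) • (volume : Measure UnitAddCircle) ≤
      (step η T)^[n] (densityMeasure h) := by
  obtain ⟨n, hn⟩ := H.exists_le h hh hh0
  have hhi := integrable_of_continuous (continuous_of_contDiff_comp_coe hh) volume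
  have := isFiniteMeasure_densityMeasure hhi
  have hne : ENNReal.ofReal c * densityMeasure h univ ≠ ⊤ :=
    ENNReal.mul_ne_top ENNReal.ofReal_ne_top (measure_ne_top _ _)
  have : IsFiniteMeasure ((ENNReal.ofReal c * densityMeasure h univ) •
      (volume : Measure UnitAddCircle)) := Measure.smul_finite _ hne
  refine ⟨n, measure_le_of_integral_le fun φ hφ hφ0 => ?_⟩
  refine le_trans (le_of_eq ?_) (hn φ hφ hφ0)
  rw [integral_smul_measure, ENNReal.toReal_mul, ENNReal.toReal_ofReal H.pos.le,
    withDensity_apply _ .univ, Measure.restrict_univ,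
    ← ofReal_integral_eq_lintegral_ofReal hhi (.of_forall fun x => (hh0 x).le),
    ENNReal.toReal_ofReal (integral_nonneg fun x => (hh0 x).le), smul_eq_mul]
  ring

/-- Approximate the density of `ν` in `L¹` by a positive `C¹` density. The chain preserves the mass
of the error, so the minorization survives up to `κ`. -/
lemma exists_smul_volume_le_add (H : IsSpreading η T c) (ν : Measure UnitAddCircle)
    [IsFiniteMeasure ν] (hν : ν ≪ volume) {ε : ℝ} (hε : 0 < ε) :
    ∃ (n : ℕ) (κ : Measure UnitAddCircle), κ univ ≤ ENNReal.ofReal ε ∧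
      (ENNReal.ofReal c * ν univ) • (volume : Measure UnitAddCircle) ≤
        (step η T)^[n] ν + κ := by
  have hc := H.pos
  set f : UnitAddCircle → ℝ := fun x => (ν.rnDeriv volume x).toReal
  have hf : Integrable f := Measure.integrable_toReal_rnDeriv
  have hfν : densityMeasure f = ν := by
    refine Eq.trans (withDensity_congr_ae ?_) (Measure.withDensity_rnDeriv_eq ν volume hν)
    filter_upwards [Measure.rnDeriv_lt_top ν volume] with x hx
    exact ENNReal.ofReal_toReal hx.ne
  have hfm : Measurable f := (Measure.measurable_rnDeriv ν volume).ennreal_toReal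
  have hε' : 0 < ε / (1 + c) := by positivity
  obtain ⟨h, hh, hh0, hfh⟩ := exists_contDiff_pos_integral_sub_le hf
    (fun x => ENNReal.toReal_nonneg) hε'
  have hhc := continuous_of_contDiff_comp_coe hh
  have hhi := integrable_of_continuous hhc volume
  obtain ⟨n, hn⟩ := H.smul_volume_le_iterate hh hh0
  set D := densityMeasure h with hD
  set κ := densityMeasure fun x => |f x - h x| with hκ
  have := isFiniteMeasure_densityMeasure hhi
  have : IsFiniteMeasure κ := isFiniteMeasure_densityMeasure (hf.sub hhi).abs
  have hκ1 : κ univ ≤ ENNReal.ofReal (ε / (1 + c)) := by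
    rw [hκ, withDensity_apply _ .univ, Measure.restrict_univ]
    refine le_trans (le_of_eq ?_) (ENNReal.ofReal_le_ofReal hfh)
    exact (ofReal_integral_eq_lintegral_ofReal (hf.sub hhi).abs
      (.of_forall fun x => abs_nonneg _)).symm
  have hκm : Measurable fun x => ENNReal.ofReal |f x - h x| :=
    (hfm.sub hhc.measurable).abs.ennreal_ofReal
  have h1 : D ≤ ν + κ := by
    rw [← hfν, hκ, ← withDensity_add_right _ hκm]
    refine withDensity_mono (.of_forall fun x => ?_)
    simp only [Pi.add_apply]
    rw [← ENNReal.ofReal_add ENNReal.toReal_nonneg (abs_nonneg _)]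
    exact ENNReal.ofReal_le_ofReal (by linarith [neg_abs_le (f x - h x)])
  have h2 : ν ≤ D + κ := by
    conv_lhs => rw [← hfν]
    rw [hκ, ← withDensity_add_right _ hκm]
    refine withDensity_mono (.of_forall fun x => ?_)
    simp only [Pi.add_apply]
    rw [← ENNReal.ofReal_add (hh0 x).le (abs_nonneg _)]
    exact ENNReal.ofReal_le_ofReal (by linarith [le_abs_self (f x - h x)])
  -- The error enters twice: transported by the chain, and through the change of total mass scaled
  -- by `c`. Hence the tolerance `ε / (1 + c)`.
  refine ⟨n, (step η T)^[n] κ + (ENNReal.ofReal c * κ univ) • volume, ?_, ?_⟩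
  · rw [Measure.add_apply, iterate_step_univ H.measurable, Measure.smul_apply,
      UnitAddCircle.measure_univ, smul_eq_mul, mul_one]
    calc κ univ + ENNReal.ofReal c * κ univ = ENNReal.ofReal (1 + c) * κ univ := by
          rw [ENNReal.ofReal_add zero_le_one hc.le, ENNReal.ofReal_one, add_mul, one_mul]
      _ ≤ ENNReal.ofReal (1 + c) * ENNReal.ofReal (ε / (1 + c)) := by gcongr
      _ = ENNReal.ofReal ε := by
          rw [← ENNReal.ofReal_mul (by positivity)]
          congr 1
          field_simp
  · have h3 : ENNReal.ofReal c * ν univ ≤ ENNReal.ofReal c * D univ + ENNReal.ofReal c * κ univ := by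
      rw [← mul_add]
      exact mul_le_mul_right (h2 univ) _
    have h4 := iterate_step_mono (η := η) H.measurable h1 n
    rw [iterate_step_add H.measurable] at h4
    intro A
    have h5 := (hn A).trans (h4 A)
    simp only [Measure.smul_apply, Measure.add_apply, smul_eq_mul] at h5 ⊢
    calc ENNReal.ofReal c * ν univ * volume A
        ≤ (ENNReal.ofReal c * D univ + ENNReal.ofReal c * κ univ) * volume A := by gcongr
      _ = ENNReal.ofReal c * D univ * volume A + ENNReal.ofReal c * κ univ * volume A := add_mul _ _ _
      _ ≤ _ := by
          rw [← add_assoc]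
          exact add_le_add_left h5 _

/-- An absolutely continuous invariant measure is bounded below. -/
lemma smul_volume_le (H : IsSpreading η T c) {ν : Measure UnitAddCircle}
    [IsFiniteMeasure ν] (hν : ν ≪ volume) (hinv : step η T ν = ν) :
    (ENNReal.ofReal c * ν univ) • (volume : Measure UnitAddCircle) ≤ ν := by
  intro A
  refine ENNReal.le_of_forall_pos_le_add fun ε hε _ => ?_
  obtain ⟨n, κ, hκ, hle⟩ := H.exists_smul_volume_le_add ν hν (ε := ε) hε
  rw [iterate_fixed hinv] at hle
  refine (hle A).trans ?_
  rw [Measure.add_apply]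
  refine add_le_add_right ((measure_mono (subset_univ A)).trans ?_) _
  simpa using hκ

/-- There is at most one absolutely continuous invariant probability measure with bounded
density. -/
lemma eq_of_step_eq (H : IsSpreading η T c) {μ ν : Measure UnitAddCircle}
    [IsProbabilityMeasure μ] [IsProbabilityMeasure ν] (hν : ν ≪ volume)
    (hμinv : step η T μ = μ) (hνinv : step η T ν = ν) {C : ℝ} (hC : 0 < C)
    (hμC : μ ≤ ENNReal.ofReal C • volume) : ν = μ := by
  have hc := H.pos
  set k := min (c / C) 1 with hk
  have hk0 : 0 < k := lt_min (by positivity) one_pos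
  have hk1 : k ≤ 1 := min_le_right _ _
  have hCμ : ∀ r : ENNReal, (ENNReal.ofReal k * r) • μ ≤
      (ENNReal.ofReal c * r) • (volume : Measure UnitAddCircle) := by
    intro r A
    simp only [Measure.smul_apply, smul_eq_mul]
    have h1 := hμC A
    simp only [Measure.smul_apply, smul_eq_mul] at h1
    calc ENNReal.ofReal k * r * μ A
        ≤ ENNReal.ofReal (c / C) * r * (ENNReal.ofReal C * volume A) := by
          gcongr
          exact min_le_left _ _
      _ = (ENNReal.ofReal (c / C) * ENNReal.ofReal C) * r * volume A := by ring
      _ = _ := by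
          rw [← ENNReal.ofReal_mul (by positivity), div_mul_cancel₀ _ hC.ne']
  -- Each round removes from the remaining invariant measure, of mass `1 - s`, a further `k (1 - s)
  -- μ`; the uncovered mass shrinks by the factor `1 - k`.
  have hind : ∀ n : ℕ, ENNReal.ofReal (1 - (1 - k) ^ n) • μ ≤ ν := by
    intro n
    induction n with
    | zero => simpa using Measure.zero_le ν
    | succ n ih =>
      set s := 1 - (1 - k) ^ n with hs
      have hp0 : 0 ≤ (1 - k) ^ n := pow_nonneg (by linarith) n
      have hs0 : 0 ≤ s := by
        rw [hs, sub_nonneg]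
        exact pow_le_one₀ (by linarith) (by linarith)
      have : IsFiniteMeasure (ENNReal.ofReal s • μ) := Measure.smul_finite _ ENNReal.ofReal_ne_top
      set ν' := ν - ENNReal.ofReal s • μ
      have hadd : ν' + ENNReal.ofReal s • μ = ν := Measure.sub_add_cancel_of_le ih
      have hν'le : ν' ≤ ν := Measure.sub_le
      have : IsFiniteMeasure ν' := isFiniteMeasure_of_le ν hν'le
      have hinv' : step η T ν' = ν' := by
        have h1 : step η T ν' + ENNReal.ofReal s • μ = ν' + ENNReal.ofReal s • μ := by
          conv_rhs => rw [hadd, ← hνinv, ← hadd, step_add H.measurable, step_smul, hμinv]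
        ext A hA
        have h2 := congrArg (fun m : Measure UnitAddCircle => m A) h1
        simp only [Measure.add_apply] at h2
        exact (ENNReal.add_left_inj (measure_ne_top _ A)).1 h2
      have hmass : ν' univ = ENNReal.ofReal (1 - s) := by
        have h2 := congrArg (fun m : Measure UnitAddCircle => m univ) hadd
        simp only [Measure.add_apply, Measure.smul_apply, measure_univ, smul_eq_mul, mul_one] at h2
        rw [ENNReal.ofReal_sub _ hs0, ENNReal.ofReal_one, ← h2,
          ENNReal.add_sub_cancel_right ENNReal.ofReal_ne_top]
      have h3 := (hCμ _).trans (H.smul_volume_le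
        ((Measure.absolutelyContinuous_of_le hν'le).trans hν) hinv')
      rw [hmass, ← ENNReal.ofReal_mul hk0.le] at h3
      have h4 : 1 - (1 - k) ^ (n + 1) = k * (1 - s) + s := by rw [hs, pow_succ]; ring
      rw [h4, ENNReal.ofReal_add (mul_nonneg hk0.le (by linarith)) hs0, add_smul, ← hadd]
      exact add_le_add_left h3 _
  have hle : μ ≤ ν := by
    intro A
    have ht : Tendsto (fun n : ℕ => ENNReal.ofReal (1 - (1 - k) ^ n) * μ A) atTop
        (𝓝 (ENNReal.ofReal (1 - 0) * μ A)) := by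
      refine ENNReal.Tendsto.mul_const (ENNReal.tendsto_ofReal (tendsto_const_nhds.sub
        (tendsto_pow_atTop_nhds_zero_of_lt_one (by linarith) (by linarith)))) (.inr ?_)
      exact measure_ne_top _ _
    simp only [sub_zero, ENNReal.ofReal_one, one_mul] at ht
    exact le_of_tendsto' ht fun n => hind n A
  exact (Measure.eq_of_le_of_isProbabilityMeasure hle).symm

end IsSpreading

end Spreading

/-! ### Ergodicity: bounded harmonic functions -/

namespace IsSpreading

variable {Ω : Type*} [MeasurableSpace Ω] {η : Measure Ω} [IsProbabilityMeasure η]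
  {T : Ω → UnitAddCircle → UnitAddCircle} {c : ℝ} {μ : Measure UnitAddCircle}

/-- As `μ` is invariant and equivalent to Lebesgue measure, one step preserves absolute continuity.
-/
lemma iterate_absolutelyContinuous (H : IsSpreading η T c) [IsProbabilityMeasure μ]
    (hμ : μ ≪ volume) (hμ' : volume ≪ μ) (hinv : step η T μ = μ) {ν : Measure UnitAddCircle}
    [IsFiniteMeasure ν] (hν : ν ≪ volume) (n : ℕ) : (step η T)^[n] ν ≪ volume := by
  induction n with
  | zero => exact hν
  | succ n ih =>
    rw [iterate_succ_apply']
    have := step_absolutelyContinuous (η := η) H.measurable (ih.trans hμ')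
    rw [hinv] at this
    exact this.trans hμ

lemma integral_iterate_of_harmonic (H : IsSpreading η T c) [IsProbabilityMeasure μ]
    (hμ : μ ≪ volume) (hμ' : volume ≪ μ) (hinv : step η T μ = μ) {f : UnitAddCircle → ℝ}
    (hf : Measurable f) {C : ℝ} (hC : ∀ x, |f x| ≤ C) (hharm : ∀ᵐ x ∂μ, markovOp η T f x = f x)
    {ν : Measure UnitAddCircle} [IsFiniteMeasure ν] (hν : ν ≪ volume) (n : ℕ) :
    ∫ x, f x ∂(step η T)^[n] ν = ∫ x, f x ∂ν := by
  induction n with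
  | zero => rfl
  | succ n ih =>
    rw [iterate_succ_apply', integral_step_swap H.measurable hf hC, ← ih]
    refine integral_congr_ae ?_
    exact ((H.iterate_absolutelyContinuous hμ hμ' hinv hν n).trans hμ').ae_le hharm

/-- Bounded harmonic functions are almost everywhere constant. -/
theorem ae_const_of_harmonic (H : IsSpreading η T c) [IsProbabilityMeasure μ]
    (hμ : μ ≪ volume) (hμ' : volume ≪ μ) (hinv : step η T μ = μ) {f : UnitAddCircle → ℝ}
    (hf : Measurable f) {C : ℝ} (hC : ∀ x, |f x| ≤ C)
    (hharm : ∀ᵐ x ∂μ, markovOp η T f x = f x) : ∃ s, ∀ᵐ x ∂μ, f x = s := by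
  have hb1 : IsBoundedUnder (· ≥ ·) (ae volume) f :=
    ⟨-C, eventually_map.2 (.of_forall fun x => neg_le_of_abs_le (hC x))⟩
  have hb2 : IsBoundedUnder (· ≤ ·) (ae volume) f :=
    ⟨C, eventually_map.2 (.of_forall fun x => le_of_abs_le (hC x))⟩
  set s := essInf f volume
  have hs : ∀ᵐ x, s ≤ f x := ae_essInf_le hb1
  set φ : UnitAddCircle → ENNReal := fun x => ENNReal.ofReal (f x - s) with hφ
  have hφm : Measurable φ := (hf.sub_const s).ennreal_ofReal
  have hφB : ∀ x, φ x ≤ ENNReal.ofReal (C + |s|) := fun x =>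
    ENNReal.ofReal_le_ofReal (by linarith [le_of_abs_le (hC x), neg_abs_le s])
  have hfi : ∀ (ν : Measure UnitAddCircle) [IsFiniteMeasure ν], Integrable f ν := fun ν _ =>
    Integrable.of_bound hf.aestronglyMeasurable C (.of_forall hC)
  have hφν : ∀ (ν : Measure UnitAddCircle) [IsFiniteMeasure ν], ν ≪ volume →
      ∫⁻ x, φ x ∂ν = ENNReal.ofReal ((∫ x, f x ∂ν) - s * ν.real univ) := by
    intro ν _ hν
    have h1 := ofReal_integral_eq_lintegral_ofReal ((hfi ν).sub (integrable_const s))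
      (by filter_upwards [hν.ae_le hs] with x hx using sub_nonneg.2 hx)
    refine h1.symm.trans ?_
    congr 1
    refine (integral_sub (hfi ν) (integrable_const s)).trans ?_
    simp [mul_comm]
  -- Harmonicity lets `∫ φ ∂ν` be evaluated at the spreading time `n`, where the law dominates a
  -- multiple of Lebesgue measure up to a negligible `κ`.
  have key : ∀ (ν : Measure UnitAddCircle) [IsFiniteMeasure ν], ν ≪ volume →
      ENNReal.ofReal c * ν univ * ∫⁻ x, φ x ≤ ∫⁻ x, φ x ∂ν := by
    intro ν _ hν
    refine ENNReal.le_of_forall_pos_le_add fun ε hε _ => ?_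
    have hB : 0 < C + |s| + 1 := by
      have := (abs_nonneg _).trans (hC 0)
      positivity
    obtain ⟨n, κ, hκ, hle⟩ := H.exists_smul_volume_le_add ν hν (ε := ε / (C + |s| + 1))
      (by positivity)
    have h1 : ∫⁻ x, φ x ∂((step η T)^[n] ν) = ∫⁻ x, φ x ∂ν := by
      rw [hφν _ (H.iterate_absolutelyContinuous hμ hμ' hinv hν n), hφν _ hν,
        H.integral_iterate_of_harmonic hμ hμ' hinv hf hC hharm hν, measureReal_def,
        iterate_step_univ H.measurable, measureReal_def]
    have h2 : ∫⁻ x, φ x ∂κ ≤ ε := by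
      calc ∫⁻ x, φ x ∂κ ≤ ∫⁻ _, ENNReal.ofReal (C + |s| + 1) ∂κ :=
            lintegral_mono fun x => (hφB x).trans (ENNReal.ofReal_le_ofReal (by linarith))
        _ = ENNReal.ofReal (C + |s| + 1) * κ univ := lintegral_const _
        _ ≤ ENNReal.ofReal (C + |s| + 1) * ENNReal.ofReal (ε / (C + |s| + 1)) := by gcongr
        _ = ε := by
            rw [← ENNReal.ofReal_mul hB.le, mul_div_cancel₀ _ hB.ne', ENNReal.ofReal_coe_nnreal]
    calc _ = ∫⁻ x, φ x ∂((ENNReal.ofReal c * ν univ) • (volume : Measure UnitAddCircle)) := by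
          rw [lintegral_smul_measure, smul_eq_mul]
      _ ≤ ∫⁻ x, φ x ∂((step η T)^[n] ν + κ) := lintegral_mono' hle le_rfl
      _ ≤ _ := by
          rw [lintegral_add_measure, h1]
          exact add_le_add_right h2 _
  have hIfin : ∫⁻ x, φ x ≠ ⊤ := by
    rw [hφν volume Measure.AbsolutelyContinuous.rfl]
    exact ENNReal.ofReal_ne_top
  -- Taking `ν` to be Lebesgue measure restricted to `A` localizes the integral inequality to a
  -- pointwise one.
  have hae : ∀ᵐ x, ENNReal.ofReal c * ∫⁻ x, φ x ≤ φ x := by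
    refine ae_le_of_forall_setLIntegral_le_of_sigmaFinite measurable_const fun A hA _ => ?_
    have := key (volume.restrict A) Measure.restrict_le_self.absolutelyContinuous
    rw [setLIntegral_const]
    rw [Measure.restrict_apply_univ] at this
    refine le_trans (le_of_eq ?_) this
    ring
  -- The pointwise bound raises the essential infimum of `f` by `c ∫ φ`, so `∫ φ` must vanish.
  have hle : s + c * (∫⁻ x, φ x).toReal ≤ s := by
    refine le_essInf_of_ae_le _ ?_ hb2.isCoboundedUnder_ge
    filter_upwards [hae, hs] with x hx hxs
    have h1 := ENNReal.toReal_mono ENNReal.ofReal_ne_top hx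
    rw [ENNReal.toReal_mul, ENNReal.toReal_ofReal H.pos.le,
      ENNReal.toReal_ofReal (sub_nonneg.2 hxs)] at h1
    linarith
  have hI : ∫⁻ x, φ x = 0 := by
    have h1 : c * (∫⁻ x, φ x).toReal ≤ 0 := by linarith
    have h2 : (∫⁻ x, φ x).toReal = 0 :=
      le_antisymm (nonpos_of_mul_nonpos_right h1 H.pos) ENNReal.toReal_nonneg
    exact ((ENNReal.toReal_eq_zero_iff _).1 h2).resolve_right hIfin
  refine ⟨s, hμ.ae_le ?_⟩
  filter_upwards [(lintegral_eq_zero_iff hφm).1 hI, hs] with x hx hxs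
  have : f x - s ≤ 0 := ENNReal.ofReal_eq_zero.1 hx
  linarith

end IsSpreading

/-! ### Existence by compactness -/

lemma norm_le_one (x : UnitAddCircle) : ‖x‖ ≤ 1 := by
  have := AddCircle.norm_le_half_period (p := 1) one_ne_zero (x := x)
  rw [abs_one] at this
  linarith

lemma exists_kernel {δ : ℝ} (hδ : 0 < δ) :
    ∃ κ : UnitAddCircle → ℝ, Continuous κ ∧ (∀ x, 0 ≤ κ x) ∧ ∫ x, κ x = 1 ∧
      ∀ x, δ ≤ ‖x‖ → κ x = 0 := by
  set b : UnitAddCircle → ℝ := fun x => max (δ - ‖x‖) 0 with hb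
  have hbc : Continuous b := (continuous_const.sub continuous_norm).max continuous_const
  have hb0 : ∀ x, 0 ≤ b x := fun x => le_max_right _ _
  have hZ : 0 < ∫ x, b x := by
    refine hbc.integral_pos_of_hasCompactSupport_nonneg_nonzero
      (HasCompactSupport.of_compactSpace b) hb0 (x := 0) ?_
    simp [hb, hδ.ne', hδ.le]
  refine ⟨fun x => b x / ∫ x, b x, hbc.div_const _, fun x => div_nonneg (hb0 x) hZ.le, ?_,
    fun x hx => ?_⟩
  · rw [integral_div, div_self hZ.ne']
  · simp [hb, hx]

/-- A probability measure on the circle that is Lipschitz with respect to translations is close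
to a measure with Lipschitz density. -/
lemma exists_lipschitz_approx {μ : Measure UnitAddCircle} [IsProbabilityMeasure μ] {c L : ℝ}
    (hL : 0 ≤ L)
    (hlow : ∀ φ : UnitAddCircle → ℝ, Continuous φ → (∀ x, 0 ≤ φ x) →
      c * ∫ x, φ x ≤ ∫ x, φ x ∂μ)
    (hlip : ∀ φ : UnitAddCircle → ℝ, Continuous φ → (∀ x, 0 ≤ φ x) → ∀ t : UnitAddCircle,
      (∫ x, φ x ∂μ) - ∫ x, φ (x + t) ∂μ ≤ L * ‖t‖ * ∫ x, φ x) {δ : ℝ} (hδ : 0 < δ) :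
    ∃ g : UnitAddCircle → ℝ, LipschitzWith L.toNNReal g ∧ (∀ x, c ≤ g x) ∧ (∀ x, g x ≤ 1 + L) ∧
      ∀ (φ : UnitAddCircle → ℝ) (ε : ℝ), Continuous φ →
        (∀ x y, dist x y < δ → |φ x - φ y| ≤ ε) →
        |(∫ x, φ x * g x) - ∫ x, φ x ∂μ| ≤ ε := by
  obtain ⟨κ, hκc, hκ0, hκ1, hκδ⟩ := exists_kernel hδ
  set g : UnitAddCircle → ℝ := fun x => ∫ y, κ (y - x) ∂μ with hg
  have hκx : ∀ x, Continuous fun y => κ (y - x) := fun x => by fun_prop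
  have hκy : ∀ y, Continuous fun x => κ (y - x) := fun y => by fun_prop
  have hκint : ∀ x, ∫ y, κ (y - x) = 1 := fun x => by rw [integral_sub_right_eq_self κ x, hκ1]
  have hκint' : ∀ y, ∫ x, κ (y - x) = 1 := fun y => by rw [integral_sub_left_eq_self κ _ y, hκ1]
  -- Translating the kernel centred at `x` by `x - x'` centres it at `x'`; its integral is `1`, so
  -- the Lipschitz constant is `L` whatever `δ` is.
  have hsub : ∀ x x', g x - g x' ≤ L * dist x x' := by
    intro x x'
    have := hlip _ (hκx x) (fun y => hκ0 _) (x - x')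
    rw [hκint, mul_one, ← dist_eq_norm] at this
    simp_rw [show ∀ y : UnitAddCircle, y + (x - x') - x = y - x' from fun y => by abel] at this
    exact this
  have hglip : LipschitzWith L.toNNReal g := by
    refine LipschitzWith.of_dist_le_mul fun x x' => ?_
    rw [Real.coe_toNNReal L hL, Real.dist_eq, abs_le]
    have h1 := hsub x x'
    have h2 := hsub x' x
    rw [dist_comm x' x] at h2
    constructor <;> linarith
  have hgc := hglip.continuous
  have hfub : ∀ φ : UnitAddCircle → ℝ, Continuous φ →
      ∫ x, φ x * g x = ∫ y, (∫ x, φ x * κ (y - x)) ∂μ := by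
    intro φ hφ
    have h1 : ∀ x, φ x * g x = ∫ y, φ x * κ (y - x) ∂μ := fun x => (integral_const_mul _ _).symm
    simp_rw [h1]
    refine integral_integral_swap ?_
    have hc : Continuous (uncurry fun x y : UnitAddCircle => φ x * κ (y - x)) := by
      simp only [uncurry_def]; fun_prop
    exact hc.integrable_of_hasCompactSupport (HasCompactSupport.of_compactSpace _)
  have happrox : ∀ (φ : UnitAddCircle → ℝ) (ε : ℝ), Continuous φ →
        (∀ x y, dist x y < δ → |φ x - φ y| ≤ ε) →
        |(∫ x, φ x * g x) - ∫ x, φ x ∂μ| ≤ ε := by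
    intro φ ε hφ hε
    have hcont : Continuous fun y => ∫ x, φ x * κ (y - x) := by
      obtain ⟨C, hC⟩ := exists_abs_le_of_continuous hφ
      obtain ⟨C', hC'⟩ := exists_abs_le_of_continuous hκc
      refine continuous_of_dominated (bound := fun _ => C * C')
        (fun y => (by fun_prop : Continuous _).aestronglyMeasurable)
        (fun y => .of_forall fun x => ?_) (integrable_const _) (.of_forall fun x => by fun_prop)
      rw [norm_mul]
      exact mul_le_mul (hC _) (hC' _) (norm_nonneg _) ((abs_nonneg _).trans (hC 0))
    rw [hfub φ hφ, ← integral_sub (integrable_of_continuous hcont μ)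
      (integrable_of_continuous hφ μ), ← Real.norm_eq_abs]
    refine (norm_integral_le_of_norm_le_const (C := ε) (.of_forall fun y => ?_)).trans (by simp)
    have h1 : (∫ x, φ x * κ (y - x)) - φ y = ∫ x, (φ x - φ y) * κ (y - x) := by
      have i1 : Integrable fun x => φ x * κ (y - x) :=
        integrable_of_continuous (hφ.mul (hκy y)) _
      have i2 : Integrable fun x => φ y * κ (y - x) :=
        integrable_of_continuous (continuous_const.mul (hκy y)) _
      simp_rw [sub_mul]
      rw [integral_sub i1 i2, integral_const_mul, hκint', mul_one]
    rw [h1]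
    calc ‖∫ x, (φ x - φ y) * κ (y - x)‖ ≤ ∫ x, ε * κ (y - x) := by
          refine norm_integral_le_of_norm_le
            (integrable_of_continuous (continuous_const.mul (hκy y)) _) (.of_forall fun x => ?_)
          rw [norm_mul, Real.norm_of_nonneg (hκ0 _)]
          rcases lt_or_ge (dist x y) δ with hd | hd
          · exact mul_le_mul_of_nonneg_right (hε x y hd) (hκ0 _)
          · rw [hκδ (y - x) (by rwa [← dist_eq_norm, dist_comm])]
            simp
      _ = ε := by rw [integral_const_mul, hκint', mul_one]
  refine ⟨g, hglip, fun x => ?_, fun x => ?_, happrox⟩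
  · have := hlow _ (hκx x) fun y => hκ0 _
    rwa [hκint, mul_one] at this
  -- Testing against `1` gives `∫ g = 1`; a function of mean `1` whose oscillation is at most `L`
  -- stays below `1 + L`.
  · have h1 := happrox (fun _ => 1) 0 continuous_const (by simp)
    simp only [one_mul, integral_const, probReal_univ, smul_eq_mul] at h1
    have h2 : ∫ _ : UnitAddCircle, (g x - L) ≤ ∫ y, g y := by
      refine integral_mono (integrable_const _) (integrable_of_continuous hgc _) fun y => ?_
      have h3 := hsub x y
      have h4 : L * dist x y ≤ L := by
        rw [dist_eq_norm]
        exact mul_le_of_le_one_right hL (norm_le_one _)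
      linarith
    simp only [integral_const, probReal_univ, one_smul] at h2
    have h5 := le_of_abs_le h1
    linarith

section Existence

variable {Ω : Type*} [MeasurableSpace Ω] {η : Measure Ω} [IsProbabilityMeasure η]
  {T : Ω → UnitAddCircle → UnitAddCircle}

lemma continuous_markovOp (hTm : Measurable fun p : Ω × UnitAddCircle => T p.1 p.2)
    (hTc : ∀ ω, Continuous (T ω)) {φ : UnitAddCircle → ℝ} (hφ : Continuous φ) :
    Continuous (markovOp η T φ) := by
  obtain ⟨C, hC⟩ := exists_abs_le_of_continuous hφ
  exact continuous_of_dominated (bound := fun _ => C)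
    (fun x => (hφ.measurable.comp
      (hTm.comp (measurable_id.prodMk measurable_const))).aestronglyMeasurable)
    (fun x => .of_forall fun ω => hC _) (integrable_const _)
    (.of_forall fun ω => hφ.comp (hTc ω))

/-- The average of the laws of the chain at the times `0, …, N`, started from Lebesgue measure. -/
noncomputable def cesaro (η : Measure Ω) (T : Ω → UnitAddCircle → UnitAddCircle) (N : ℕ) :
    Measure UnitAddCircle :=
  ((N : ENNReal) + 1)⁻¹ • ∑ n ∈ Finset.range (N + 1), (step η T)^[n] volume

lemma integral_cesaro {φ : UnitAddCircle → ℝ} (hφ : Continuous φ) (N : ℕ) :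
    ∫ x, φ x ∂cesaro η T N =
      ((N : ℝ) + 1)⁻¹ * ∑ n ∈ Finset.range (N + 1), ∫ x, φ x ∂(step η T)^[n] volume := by
  rw [cesaro, integral_smul_measure, integral_finsetSum_measure
    fun n _ => integrable_of_continuous hφ _, smul_eq_mul, ENNReal.toReal_inv,
    ENNReal.toReal_add (by simp) (by simp)]
  simp

lemma isProbabilityMeasure_cesaro (hTm : Measurable fun p : Ω × UnitAddCircle => T p.1 p.2)
    (N : ℕ) : IsProbabilityMeasure (cesaro η T N) := by
  refine ⟨?_⟩
  rw [cesaro, Measure.smul_apply, Measure.finsetSum_apply]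
  simp only [iterate_step_univ hTm, UnitAddCircle.measure_univ, Finset.sum_const, Finset.card_range,
    nsmul_eq_mul, mul_one, smul_eq_mul, Nat.cast_add, Nat.cast_one]
  exact ENNReal.inv_mul_cancel (by simp) (by simp)

/-- Telescoping: only the two end terms survive, so the averages are asymptotically invariant. -/
lemma integral_cesaro_markovOp_sub (hTm : Measurable fun p : Ω × UnitAddCircle => T p.1 p.2)
    (hTc : ∀ ω, Continuous (T ω)) {φ : UnitAddCircle → ℝ} (hφ : Continuous φ) (N : ℕ) :
    (∫ x, markovOp η T φ x ∂cesaro η T N) - ∫ x, φ x ∂cesaro η T N =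
      ((N : ℝ) + 1)⁻¹ * ((∫ x, φ x ∂(step η T)^[N + 1] volume) - ∫ x, φ x) := by
  obtain ⟨C, hC⟩ := exists_abs_le_of_continuous hφ
  rw [integral_cesaro (continuous_markovOp hTm hTc hφ), integral_cesaro hφ, ← mul_sub,
    ← Finset.sum_sub_distrib]
  congr 1
  have : ∀ n, ∫ x, markovOp η T φ x ∂(step η T)^[n] volume =
      ∫ x, φ x ∂(step η T)^[n + 1] volume := fun n => by
    rw [iterate_succ_apply', integral_step_swap hTm hφ.measurable hC]
  simp_rw [this]
  rw [Finset.sum_range_sub (fun n => ∫ x, φ x ∂(step η T)^[n] volume)]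
  rfl

lemma tendsto_integral_cesaro_markovOp_sub
    (hTm : Measurable fun p : Ω × UnitAddCircle => T p.1 p.2)
    (hTc : ∀ ω, Continuous (T ω)) {φ : UnitAddCircle → ℝ} (hφ : Continuous φ) :
    Tendsto (fun N => (∫ x, markovOp η T φ x ∂cesaro η T N) - ∫ x, φ x ∂cesaro η T N) atTop
      (𝓝 0) := by
  obtain ⟨C, hC⟩ := exists_abs_le_of_continuous hφ
  have h1 : Tendsto (fun N : ℕ => 1 / ((N : ℝ) + 1) * (C + C)) atTop (𝓝 (0 * (C + C))) :=
    tendsto_one_div_add_atTop_nhds_zero_nat.mul_const _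
  rw [zero_mul] at h1
  refine squeeze_zero_norm (fun N => ?_) h1
  rw [integral_cesaro_markovOp_sub hTm hTc hφ, norm_mul, norm_inv, one_div,
    Real.norm_of_nonneg (by positivity : (0 : ℝ) ≤ (N : ℝ) + 1)]
  refine mul_le_mul_of_nonneg_left ((norm_sub_le _ _).trans (add_le_add ?_ ?_)) (by positivity)
  · have : IsProbabilityMeasure ((step η T)^[N + 1] volume) :=
      ⟨by rw [iterate_step_univ hTm, UnitAddCircle.measure_univ]⟩
    exact (norm_integral_le_of_norm_le_const (.of_forall hC)).trans
      (by rw [probReal_univ, mul_one])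
  · exact (norm_integral_le_of_norm_le_const (.of_forall hC)).trans (by simp)

/-- If the laws of the chain started from Lebesgue measure are uniformly Lipschitz and bounded
below, there is an invariant probability measure with Lipschitz density bounded below. -/
theorem exists_invariant_lipschitz (hTm : Measurable fun p : Ω × UnitAddCircle => T p.1 p.2)
    (hTc : ∀ ω, Continuous (T ω)) {c L : ℝ} (hc : 0 < c) (hL : 0 ≤ L)
    (hlow : ∀ (n : ℕ) (φ : UnitAddCircle → ℝ), Continuous φ → (∀ x, 0 ≤ φ x) →
      c * ∫ x, φ x ≤ ∫ x, φ x ∂(step η T)^[n] volume)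
    (hlip : ∀ (n : ℕ) (φ : UnitAddCircle → ℝ), Continuous φ → (∀ x, 0 ≤ φ x) →
      ∀ t : UnitAddCircle, (∫ x, φ x ∂(step η T)^[n] volume) -
        ∫ x, φ (x + t) ∂(step η T)^[n] volume ≤ L * ‖t‖ * ∫ x, φ x) :
    ∃ g : UnitAddCircle → ℝ, LipschitzWith L.toNNReal g ∧ (∀ x, c ≤ g x) ∧
      IsProbabilityMeasure (densityMeasure g) ∧
      step η T (densityMeasure g) = densityMeasure g := by
  have hprob := isProbabilityMeasure_cesaro (η := η) hTm
  have hpos : ∀ N : ℕ, (0 : ℝ) < (N : ℝ) + 1 := fun N => by positivity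
  have hex := fun N : ℕ => exists_lipschitz_approx (μ := cesaro η T N) (c := c) hL
    (fun φ hφ hφ0 => by
      rw [integral_cesaro hφ, ← div_eq_inv_mul, le_div_iff₀ (hpos N)]
      refine le_trans (le_of_eq ?_) (Finset.card_nsmul_le_sum _ _ (c * ∫ x, φ x)
        fun n _ => hlow n φ hφ hφ0)
      simp [mul_comm])
    (fun φ hφ hφ0 t => by
      have hφt : Continuous fun x => φ (x + t) := by fun_prop
      rw [integral_cesaro hφ, integral_cesaro hφt, ← mul_sub, ← Finset.sum_sub_distrib,
        ← div_eq_inv_mul, div_le_iff₀ (hpos N)]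
      refine (Finset.sum_le_card_nsmul _ _ _ fun n _ => hlip n φ hφ hφ0 t).trans (le_of_eq ?_)
      simp [mul_comm])
    (Nat.one_div_pos_of_nat (n := N))
  choose g hg1 hg2 hg3 hg4 using hex
  -- The averages are smoothed at scale `1 / (N + 1)`. Uniform bounds and a common Lipschitz
  -- constant give compactness, while the smoothing disappears in the limit.
  set G : ℕ → BoundedContinuousFunction UnitAddCircle ℝ := fun N =>
    BoundedContinuousFunction.mkOfCompact ⟨g N, (hg1 N).continuous⟩
  have hG : ∀ N x, G N x = g N x := fun N x => rfl
  have hcomp : IsCompact (closure (range G)) := by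
    refine BoundedContinuousFunction.arzela_ascoli (Icc c (1 + L)) isCompact_Icc _ ?_ ?_
    · rintro _ x ⟨N, rfl⟩
      exact ⟨hg2 N x, hg3 N x⟩
    · refine (LipschitzWith.uniformEquicontinuous _ L.toNNReal ?_).equicontinuous
      rintro ⟨_, N, rfl⟩
      exact hg1 N
  obtain ⟨γ, -, ψ, hψ, hlim⟩ := hcomp.tendsto_subseq
    (x := G) fun N => subset_closure (mem_range_self N)
  have hpt : ∀ x, Tendsto (fun j => g (ψ j) x) atTop (𝓝 (γ x)) := fun x =>
    ((continuous_eval_const x).tendsto γ).comp hlim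
  have hγlip : LipschitzWith L.toNNReal γ := by
    refine LipschitzWith.of_dist_le_mul fun x y => ?_
    exact le_of_tendsto' ((hpt x).dist (hpt y)) fun j => (hg1 (ψ j)).dist_le_mul x y
  have hγc : ∀ x, c ≤ γ x := fun x => ge_of_tendsto' (hpt x) fun j => hg2 _ x
  have hγ0 : ∀ x, 0 ≤ γ x := fun x => hc.le.trans (hγc x)
  have hconv : ∀ φ : UnitAddCircle → ℝ, Continuous φ →
      Tendsto (fun j => ∫ x, φ x ∂cesaro η T (ψ j)) atTop (𝓝 (∫ x, φ x * γ x)) := by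
    intro φ hφ
    have h1 : Tendsto (fun j => ∫ x, φ x * g (ψ j) x) atTop (𝓝 (∫ x, φ x * γ x)) := by
      refine tendsto_integral_of_dominated_convergence (fun x => |φ x| * (1 + L)) ?_ ?_ ?_ ?_
      · exact fun j => (hφ.mul (hg1 _).continuous).aestronglyMeasurable
      · exact integrable_of_continuous (hφ.abs.mul continuous_const) _
      · refine fun j => .of_forall fun x => ?_
        rw [norm_mul, Real.norm_of_nonneg (hc.le.trans (hg2 (ψ j) x)), Real.norm_eq_abs]
        exact mul_le_mul_of_nonneg_left (hg3 _ x) (abs_nonneg _)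
      · exact .of_forall fun x => (hpt x).const_mul _
    have h2 : Tendsto (fun N => (∫ x, φ x * g N x) - ∫ x, φ x ∂cesaro η T N) atTop (𝓝 0) := by
      rw [Metric.tendsto_atTop]
      intro ε hε
      obtain ⟨δ, hδ, hδε⟩ := Metric.uniformContinuous_iff.1
        (CompactSpace.uniformContinuous_of_continuous hφ) (ε / 2) (half_pos hε)
      obtain ⟨N₀, hN₀⟩ := exists_nat_one_div_lt hδ
      refine ⟨N₀, fun N hN => ?_⟩
      rw [Real.dist_0_eq_abs]
      refine (hg4 N φ (ε / 2) hφ fun x y hxy => ?_).trans_lt (half_lt_self hε)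
      rw [← Real.dist_eq]
      refine (hδε (hxy.trans (lt_of_le_of_lt ?_ hN₀))).le
      exact Nat.one_div_le_one_div hN
    have h3 := h1.sub (h2.comp hψ.tendsto_atTop)
    rw [sub_zero] at h3
    exact h3.congr fun j => by simp
  have hγm := hγlip.continuous.measurable
  have hfin := isFiniteMeasure_densityMeasure (integrable_of_continuous hγlip.continuous volume)
  refine ⟨γ, hγlip, hγc, ⟨?_⟩, ?_⟩
  · have h1 := hconv (fun _ => 1) continuous_const
    simp only [integral_const, probReal_univ, smul_eq_mul, mul_one, one_mul] at h1
    have h2 := tendsto_nhds_unique h1 tendsto_const_nhds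
    rw [withDensity_apply _ .univ, Measure.restrict_univ, ← ofReal_integral_eq_lintegral_ofReal
      (integrable_of_continuous hγlip.continuous volume) (.of_forall hγ0), h2, ENNReal.ofReal_one]
  -- The Markov operator maps continuous functions to continuous ones, so weak limits may be taken
  -- on both sides of the asymptotic invariance.
  · refine ext_of_forall_integral_eq_of_IsFiniteMeasure fun φ => ?_
    obtain ⟨C, hC⟩ := exists_abs_le_of_continuous φ.continuous
    rw [integral_step_swap hTm φ.continuous.measurable hC, integral_densityMeasure hγm hγ0,
      integral_densityMeasure hγm hγ0]
    have h1 := (hconv _ (continuous_markovOp (η := η) hTm hTc φ.continuous)).sub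
      (hconv _ φ.continuous)
    have h2 := (tendsto_integral_cesaro_markovOp_sub (η := η) hTm hTc φ.continuous).comp
      hψ.tendsto_atTop
    exact sub_eq_zero.1 (tendsto_nhds_unique h1 h2)

end Existence

section

variable {Ω : Type*} [MeasurableSpace Ω] {η : Measure Ω} [IsProbabilityMeasure η]
  {T : Ω → UnitAddCircle → UnitAddCircle} {μ : Measure UnitAddCircle}

lemma isStationary_of_step_eq [IsProbabilityMeasure μ]
    (hT : Measurable fun p : Ω × UnitAddCircle => T p.1 p.2) (h : step η T μ = μ) :
    IsStationary η T μ where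
  isProbabilityMeasure := inferInstance
  integral_markovOp f hf := by
    rintro ⟨C, hC⟩
    rw [← integral_step_swap hT hf hC, h]

lemma IsStationary.step_eq (hT : Measurable fun p : Ω × UnitAddCircle => T p.1 p.2)
    (h : IsStationary η T μ) : step η T μ = μ := by
  have := h.isProbabilityMeasure
  refine ext_of_forall_integral_eq_of_IsFiniteMeasure fun f => ?_
  obtain ⟨C, hC⟩ := exists_abs_le_of_continuous f.continuous
  rw [integral_step_swap hT f.continuous.measurable hC]
  exact h.integral_markovOp f f.continuous.measurable ⟨C, hC⟩

end

lemma HasLipschitzPositiveDensity.volume_absolutelyContinuous {μ : Measure UnitAddCircle}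
    (h : HasLipschitzPositiveDensity μ) : volume ≪ μ := by
  obtain ⟨φ, ⟨L, hL⟩, ⟨c, hc, hφ⟩, rfl⟩ := h
  refine withDensity_absolutelyContinuous' hL.continuous.measurable.ennreal_ofReal.aemeasurable
    (.of_forall fun x => ?_)
  exact (ENNReal.ofReal_pos.2 (hc.trans_le (hφ x))).ne'

lemma HasLipschitzPositiveDensity.absolutelyContinuous {μ : Measure UnitAddCircle}
    (h : HasLipschitzPositiveDensity μ) : μ ≪ volume := by
  obtain ⟨φ, -, -, rfl⟩ := h
  exact withDensity_absolutelyContinuous _ _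

lemma HasLipschitzPositiveDensity.exists_le_smul {μ : Measure UnitAddCircle}
    (h : HasLipschitzPositiveDensity μ) :
    ∃ C : ℝ, 0 < C ∧ μ ≤ ENNReal.ofReal C • volume := by
  obtain ⟨φ, ⟨L, hL⟩, -, rfl⟩ := h
  obtain ⟨C, hC⟩ := exists_abs_le_of_continuous hL.continuous
  refine ⟨C + 1, by linarith [(abs_nonneg _).trans (hC 0)], ?_⟩
  rw [← withDensity_const]
  exact withDensity_mono (.of_forall fun x =>
    ENNReal.ofReal_le_ofReal (by linarith [le_of_abs_le (hC x)]))

end RandomCircle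

theorem mainTheorem7 {Ω : Type*} [MeasurableSpace Ω] (η : MeasureTheory.Measure Ω)
    [MeasureTheory.IsProbabilityMeasure η]
    (T : Ω → UnitAddCircle → UnitAddCircle) (F : Ω → ℝ → ℝ)
    (hT : RandomCircle.IsAdmissible η T F) :
    (∃ μ : MeasureTheory.Measure UnitAddCircle,
      RandomCircle.IsStationary η T μ ∧ RandomCircle.HasLipschitzPositiveDensity μ) ∧
    ∀ μ : MeasureTheory.Measure UnitAddCircle,
      RandomCircle.IsStationary η T μ → RandomCircle.HasLipschitzPositiveDensity μ →
        MeasureTheory.Measure.AbsolutelyContinuous μ MeasureTheory.volume ∧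
        RandomCircle.IsErgodic η T μ ∧
        ∀ ν : MeasureTheory.Measure UnitAddCircle,
          MeasureTheory.Measure.AbsolutelyContinuous ν MeasureTheory.volume →
          RandomCircle.IsErgodic η T ν → ν = μ := by
  obtain ⟨c, L, hc, hL, hlow, hlip, hspread⟩ :=
    hT.isControlled.exists_uniform_bounds hT.integral_sq_inv_lt_one
  have H : RandomCircle.IsSpreading η T c := ⟨hT.measurable, hc, hspread⟩
  refine ⟨?_, fun μ hμ hdens => ?_⟩
  · obtain ⟨g, hg, hgc, _, hinv⟩ := RandomCircle.exists_invariant_lipschitz hT.measurable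
      (fun ω => (hT.isC2Lift ω).continuous) hc hL hlow hlip
    exact ⟨_, RandomCircle.isStationary_of_step_eq hT.measurable hinv, g, ⟨_, hg⟩, ⟨c, hc, hgc⟩, rfl⟩
  · have := hμ.isProbabilityMeasure
    have hinv := hμ.step_eq hT.measurable
    refine ⟨hdens.absolutelyContinuous, ⟨hμ, ?_⟩, fun ν hν hνerg => ?_⟩
    · rintro f hf ⟨C, hC⟩ hharm
      exact H.ae_const_of_harmonic hdens.absolutelyContinuous hdens.volume_absolutelyContinuous
        hinv hf hC hharm
    · have := hνerg.isStationary.isProbabilityMeasure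
      obtain ⟨C, hC, hle⟩ := hdens.exists_le_smul
      exact H.eq_of_step_eq hν hinv (hνerg.isStationary.step_eq hT.measurable) hC hle
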